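/- **Setting.** Let $k<0$ be an integer, $N\ge 1$ an integer, and $\chi$ a Dirichlet character modulo $N$ with $\chi(-1)=(-1)^k$. Let $f$ and $g$ be the functions on the upper half-plane $\mathbb H$ given, with $\tau=u+iv$ and $q=e^{2\pi i\tau}$, by $$f(\tau)=\sum_{n\ge 0}c_f^+(n)q^n+c_f^-(0)v^{1-k}+\sum_{n<0}c_f^-(n)\,\Gamma(1-k,-4\pi n v)\,q^n,$$ $$g(\tau)=\sum_{n\ge 0}c_g^+(n)q^n+c_g^-(0)v^{1-k}+\sum_{n<0}c_g^-(n)\,\Gamma(1-k,-4\pi n v)\,q^n,$$ where $\Gamma(s,x)=\int_x^\infty e^{-t}t^{s-1}\,dt$ and, for some $\alpha\ge 0$, the coefficients of index $n\neq 0$ are $O(|n|^\alpha)$. For a Dirichlet character $\psi$ put $$f_\psi(\tau)=\sum_{n\ge 0}\psi(n)c_f^+(n)q^n+\psi(0)c_f^-(0)v^{1-k}+\sum_{n<0}\psi(n)c_f^-(n)\,\Gamma(1-k,-4\pi n v)\,q^n,$$ and define $g_\psi$ likewise. For a real matrix $\gamma=\begin{pmatrix}a&b\\c&d\end{pmatrix}$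 with $\det\gamma>0$ let $$(f|_k\gamma)(\tau)=(\det\gamma)^{k/2}(c\tau+d)^{-k}f\!\left(\frac{a\tau+b}{c\tau+d}\right),$$ and let $\omega(M)=\begin{pmatrix}0&-1\\M&0\end{pmatrix}$. For a primitive Dirichlet character $\psi$ of conductor $M$ let $\tau(\psi)=\sum_{a=0}^{M-1}\psi(a)e^{2\pi i a/M}$ and $$C_\psi=\chi(M)\,\psi(-N)\,\tau(\psi)/\tau(\overline\psi).$$ Let $\mathcal P$ be a set of numbers coprime to $N$, each of which is an odd prime or $4$, such that $\mathcal P$ meets every arithmetic progression $\{a+tb:\ t\in\mathbb Z\}$ with $a,b$ coprime integers and $b\ne0$. **Theorem.** Let $m$ and $n$ each be an odd prime or $4$, both coprime to $N$. Suppose that $f|_k\omega(N)=g$ and that $$f_\psi|_k\,\omega(NM^2)=C_\psi\, g_{\overline\psi}$$ for all primitive Dirichlet characters $\psi$ whose conductor $M$ is $m$, or $n$, or an element of $\mathcal P$. Then $$g|_k\gamma=\overline{\chi}(n)\,g$$ for every $\gamma\in\Gamma_0(N)$ of the form $\gamma=\begin{pmatrix}m&-v\\-Nu&n\end{pmatrix}$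 with $u,v\in\mathbb Z$. -/

import Mathlib

open scoped MatrixGroups
open UpperHalfPlane

noncomputable section

/-- The incomplete gamma function `Γ(s, x) = ∫_x^∞ e^{-t} t^{s-1} dt` for real `s` and `x > 0`. -/
def upperGamma (s x : ℝ) : ℝ := ∫ t in Set.Ioi x, Real.exp (-t) * t ^ (s - 1)

/-- Fourier coefficients of a series of the shape
`∑_{n ≥ 0} c⁺(n) q^n + c⁻(0) v^{1-k} + ∑_{n < 0} c⁻(n) Γ(1-k, -4π n v) q^n`.
Here `plus n = c⁺(n)`, and `minus n = c⁻(-n)` (so `minus` is indexed by `|n|`). -/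
structure FourierCoeffs where
  plus : ℕ → ℂ
  minus : ℕ → ℂ

namespace FourierCoeffs

/-- The coefficients `c^±(n)` are `O(|n|^α)` for some `α ≥ 0`. -/
def PolyBounded (c : FourierCoeffs) : Prop :=
  ∃ α : ℝ, 0 ≤ α ∧ ∃ C : ℝ, ∀ n : ℕ, 1 ≤ n →
    ‖c.plus n‖ ≤ C * (n : ℝ) ^ α ∧ ‖c.minus n‖ ≤ C * (n : ℝ) ^ α

/-- The function on the upper half-plane given by the Fourier series in weight `k`.
The index `n` of the second sum stands for the exponent `-(n + 1) < 0`. -/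
def toFun (k : ℤ) (c : FourierCoeffs) (τ : ℍ) : ℂ :=
  ∑' n : ℕ, c.plus n * Complex.exp (2 * Real.pi * Complex.I * (n : ℂ) * (τ : ℂ))
    + c.minus 0 * ((τ.im ^ (1 - k) : ℝ) : ℂ)
    + ∑' n : ℕ, c.minus (n + 1)
        * (upperGamma ((1 - k : ℤ) : ℝ) (4 * Real.pi * ((n : ℝ) + 1) * τ.im) : ℂ)
        * Complex.exp (2 * Real.pi * Complex.I * (-((n : ℂ) + 1)) * (τ : ℂ))

/-- Twist by a Dirichlet character: the coefficients of index `n ∈ ℤ` are multiplied by `ψ(n)`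
(recall that `minus n` is the coefficient of index `-n`). -/
def twist {M : ℕ} (c : FourierCoeffs) (ψ : DirichletCharacter ℂ M) : FourierCoeffs where
  plus n := ψ (n : ZMod M) * c.plus n
  minus n := ψ (-(n : ZMod M)) * c.minus n

end FourierCoeffs

/-- The weight `k` slash operator
`(f|_k γ)(τ) = (det γ)^{k/2} (c τ + d)^{-k} f(γ τ)` for `γ` of positive determinant. -/
def slashOp (k : ℤ) (f : ℍ → ℂ) (γ : GL(2, ℝ)⁺) (τ : ℍ) : ℂ :=
  (((((γ : GL (Fin 2) ℝ) : Matrix (Fin 2) (Fin 2) ℝ).det ^ ((k : ℝ) / 2) : ℝ)) : ℂ)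
    * denom (γ : GL (Fin 2) ℝ) (τ : ℂ) ^ (-k) * f ((γ : GL (Fin 2) ℝ) • τ)

lemma fricke_det (M : ℕ) : (!![(0 : ℝ), -1; (M : ℝ), 0]).det = M := by
  simp [Matrix.det_fin_two]

/-- The Fricke matrix `ω(M) = (0, -1; M, 0)`. -/
def frickeMatrix (M : ℕ) [NeZero M] : GL(2, ℝ)⁺ :=
  ⟨Matrix.GeneralLinearGroup.mkOfDetNeZero !![(0 : ℝ), -1; (M : ℝ), 0]
      (by rw [fricke_det]; exact_mod_cast NeZero.ne M),
    by
      change 0 < (!![(0 : ℝ), -1; (M : ℝ), 0]).det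
      rw [fricke_det]
      exact_mod_cast Nat.pos_of_ne_zero (NeZero.ne M)⟩

/-- An integral matrix of determinant `1`, viewed as a real matrix of positive determinant. -/
def intToGLPos (γ : SL(2, ℤ)) : GL(2, ℝ)⁺ :=
  Matrix.SpecialLinearGroup.toGLPos (Matrix.SpecialLinearGroup.map (Int.castRingHom ℝ) γ)

/-- The Gauss sum `τ(ψ) = ∑_{a mod M} ψ(a) e^{2π i a / M}`. -/
def dirichletGaussSum {M : ℕ} [NeZero M] (ψ : DirichletCharacter ℂ M) : ℂ :=
  gaussSum ψ ZMod.stdAddChar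

/-- The constant `C_ψ = χ(M) ψ(-N) τ(ψ) / τ(ψ̄)` for `ψ` modulo `M`. -/
def twistConst {N M : ℕ} [NeZero M] (χ : DirichletCharacter ℂ N)
    (ψ : DirichletCharacter ℂ M) : ℂ :=
  χ (M : ZMod N) * ψ (-(N : ZMod M)) * dirichletGaussSum ψ / dirichletGaussSum (star ψ)

/-- The relation `f_ψ|_k ω(N M²) = C_ψ g_ψ̄`. -/
def TwistedFrickeRelation {N M : ℕ} [NeZero N] [NeZero M] (k : ℤ) (χ : DirichletCharacter ℂ N)
    (f g : FourierCoeffs) (ψ : DirichletCharacter ℂ M) : Prop :=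
  haveI : NeZero (N * M ^ 2) := ⟨mul_ne_zero (NeZero.ne N) (pow_ne_zero 2 (NeZero.ne M))⟩
  slashOp k ((f.twist ψ).toFun k) (frickeMatrix (N * M ^ 2))
    = fun τ => twistConst χ ψ * (g.twist (star ψ)).toFun k τ

/-- `M` is an odd prime number or `4`. -/
def IsOddPrimeOrFour (M : ℕ) : Prop := (M.Prime ∧ Odd M) ∨ M = 4

/-- `P` is a set of odd primes or `4`, all coprime to `N`, which meets every arithmetic
progression `{a + t b : t ∈ ℤ}` with `a`, `b` coprime and `b ≠ 0`. -/
def IsTwistSet (N : ℕ) (P : Set ℕ) : Prop :=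
  (∀ p ∈ P, IsOddPrimeOrFour p ∧ p.Coprime N) ∧
    ∀ a b : ℤ, b ≠ 0 → IsCoprime a b → ∃ p ∈ P, ∃ t : ℤ, (p : ℤ) = a + t * b

end

/-! The argument is Weil's, adapted to functions that are only continuous. Put h = χ(m) g − g|γ;
since mn ≡ 1 mod N, the claim is h = 0. Gauss sums write a primitive twist as a combination of
translates by a/M. Every nontrivial character modulo an odd prime or 4 is primitive, so
orthogonality turns the functional equations into the statement that `twistDefect` does not depend
on the residue class (`twistDefect_eq`). A matrix identity recognises this defect as a translate of
χ(M) g − g|γ. Comparing the residues v and −v, once modulo m and once modulo n, gives h|B = h with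
tr B = 4/(mn) − 2 (`exists_elliptic_slashOp_defect`). This B is elliptic, and of infinite order
because its trace is rational but not an integer.

For holomorphic h one such B would be enough; here a second one is used. Take p ≠ m in P with p ≡ m
mod Nu. Passing from m to p multiplies γ on the left by an integral translation, so h is unchanged,
but the elliptic fixed point moves.

Two such matrices force h = 0 (`eq_zero_of_two_elliptic`). As the weight is nonzero, h vanishes at a
fixed point. The powers of each matrix are dense among the rotations about its fixed point, so by
continuity the zero set is a union of hyperbolic circles about each of two distinct centres. Such a
set, once it contains a centre, is all of ℍ (`mem_of_dist_invariant`). -/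

section UpperGamma

/-! ### Decay and continuity of the incomplete gamma function. -/

open MeasureTheory Set

lemma continuous_upperGamma_integrand {s : ℝ} (hs : 1 ≤ s) :
    Continuous fun t : ℝ => Real.exp (-t) * t ^ (s - 1) :=
  (Real.continuous_exp.comp continuous_neg).mul
    (continuous_id.rpow_const fun _ => Or.inr (by linarith))

lemma integrableOn_exp_neg_mul_mul_rpow {s b : ℝ} (hs : 1 ≤ s) (hb : 0 < b) :
    IntegrableOn (fun t : ℝ => Real.exp (-b * t) * t ^ (s - 1)) (Ioi 0) := by
  have := integrableOn_rpow_mul_exp_neg_mul_rpow (s := s - 1) (p := 1) (b := b)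
    (by linarith) one_pos hb
  refine this.congr_fun (fun t _ => ?_) measurableSet_Ioi
  simp [mul_comm]

lemma upperGamma_nonneg (s : ℝ) {x : ℝ} (hx : 0 ≤ x) : 0 ≤ upperGamma s x :=
  setIntegral_nonneg measurableSet_Ioi fun _ ht =>
    mul_nonneg (Real.exp_pos _).le (Real.rpow_nonneg (hx.trans (le_of_lt ht)) _)

/-- Exponential decay of the incomplete gamma function. -/
lemma exists_upperGamma_le {s : ℝ} (hs : 1 ≤ s) :
    ∃ C : ℝ, 0 ≤ C ∧ ∀ x : ℝ, 0 ≤ x → upperGamma s x ≤ C * Real.exp (-(3 / 4) * x) := by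
  -- Split e^{-t} = e^{-3t/4} e^{-t/4}. At x = 4πnv any rate strictly between 1/2 and 1 would serve,
  -- since it must beat |q^{-n}| = e^{2πnv}.
  refine ⟨∫ t in Ioi (0 : ℝ), Real.exp (-(1 / 4) * t) * t ^ (s - 1),
    setIntegral_nonneg measurableSet_Ioi fun _ ht =>
      mul_nonneg (Real.exp_pos _).le (Real.rpow_nonneg (le_of_lt ht) _), fun x hx => ?_⟩
  have hsub : Ioi x ⊆ Ioi 0 := Ioi_subset_Ioi hx
  have hi := integrableOn_exp_neg_mul_mul_rpow hs (b := 1 / 4) (by norm_num)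
  have h1 : IntegrableOn (fun t : ℝ => Real.exp (-t) * t ^ (s - 1)) (Ioi x) := by
    simpa using (integrableOn_exp_neg_mul_mul_rpow hs one_pos).mono_set hsub
  calc upperGamma s x
      ≤ ∫ t in Ioi x, Real.exp (-(3 / 4) * x) * (Real.exp (-(1 / 4) * t) * t ^ (s - 1)) := by
        refine setIntegral_mono_on h1 ((hi.mono_set hsub).const_mul _) measurableSet_Ioi
          fun t ht => ?_
        rw [← mul_assoc, ← Real.exp_add]
        refine mul_le_mul_of_nonneg_right (Real.exp_le_exp.2 ?_)
          (Real.rpow_nonneg (hx.trans (le_of_lt ht)) _)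
        have : x < t := ht
        linarith
    _ = Real.exp (-(3 / 4) * x) * ∫ t in Ioi x, Real.exp (-(1 / 4) * t) * t ^ (s - 1) :=
        integral_const_mul _ _
    _ ≤ _ := by
        rw [mul_comm]
        refine mul_le_mul_of_nonneg_right ?_ (Real.exp_pos _).le
        refine setIntegral_mono_set hi ?_ hsub.eventuallyLE
        exact (ae_restrict_mem measurableSet_Ioi).mono fun t ht =>
          mul_nonneg (Real.exp_pos _).le (Real.rpow_nonneg (le_of_lt ht) _)

lemma continuousOn_upperGamma {s : ℝ} (hs : 1 ≤ s) : ContinuousOn (upperGamma s) (Ici 0) := by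
  have h0 : IntegrableOn (fun t : ℝ => Real.exp (-t) * t ^ (s - 1)) (Ioi 0) := by
    simpa using integrableOn_exp_neg_mul_mul_rpow hs one_pos
  have hc := intervalIntegral.continuous_primitive (μ := volume)
    (fun a b => (continuous_upperGamma_integrand hs).intervalIntegrable a b) 0
  refine (continuousOn_const.sub hc.continuousOn :
    ContinuousOn (fun x => (∫ t in Ioi (0 : ℝ), Real.exp (-t) * t ^ (s - 1)) -
      ∫ t in (0 : ℝ)..x, Real.exp (-t) * t ^ (s - 1)) (Ici 0)).congr fun x hx => ?_
  have := intervalIntegral.integral_interval_add_Ioi h0 (h0.mono_set (Ioi_subset_Ioi hx))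
  simp only [upperGamma]
  simp only [Pi.sub_apply]
  linear_combination this

end UpperGamma

/-! ### Convergence, continuity and twists of the Fourier series. -/

namespace FourierCoeffs

variable {c : FourierCoeffs}

/-- Enlarging the constant absorbs index 0, and a natural exponent on n + 1 replaces the real α. -/
lemma PolyBounded.exists_le (hc : c.PolyBounded) :
    ∃ C : ℝ, 0 ≤ C ∧ ∃ d : ℕ, ∀ n : ℕ,
      ‖c.plus n‖ ≤ C * ((n : ℝ) + 1) ^ d ∧ ‖c.minus n‖ ≤ C * ((n : ℝ) + 1) ^ d := by
  obtain ⟨α, hα, C, hC⟩ := hc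
  refine ⟨|C| + ‖c.plus 0‖ + ‖c.minus 0‖, by positivity, ⌈α⌉₊, fun n => ?_⟩
  have hone : (1 : ℝ) ≤ ((n : ℝ) + 1) ^ ⌈α⌉₊ := one_le_pow₀ (by linarith [n.cast_nonneg (α := ℝ)])
  rcases Nat.eq_zero_or_pos n with rfl | hn
  · constructor
    · refine le_trans ?_ (le_mul_of_one_le_right (by positivity) hone)
      linarith [abs_nonneg C, norm_nonneg (c.minus 0)]
    · refine le_trans ?_ (le_mul_of_one_le_right (by positivity) hone)
      linarith [abs_nonneg C, norm_nonneg (c.plus 0)]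
  · have hle : C * (n : ℝ) ^ α ≤ (|C| + ‖c.plus 0‖ + ‖c.minus 0‖) * ((n : ℝ) + 1) ^ ⌈α⌉₊ := by
      have h1 : (n : ℝ) ^ α ≤ ((n : ℝ) + 1) ^ ⌈α⌉₊ := by
        rw [← Real.rpow_natCast]
        calc (n : ℝ) ^ α ≤ ((n : ℝ) + 1) ^ α :=
              Real.rpow_le_rpow (by positivity) (by linarith) hα
          _ ≤ _ := Real.rpow_le_rpow_of_exponent_le
              (by linarith [n.cast_nonneg (α := ℝ)]) (Nat.le_ceil α)
      calc C * (n : ℝ) ^ α ≤ |C| * (n : ℝ) ^ α :=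
            mul_le_mul_of_nonneg_right (le_abs_self C) (by positivity)
        _ ≤ _ := mul_le_mul (by linarith [norm_nonneg (c.plus 0), norm_nonneg (c.minus 0)]) h1
            (by positivity) (by positivity)
    exact ⟨(hC n hn).1.trans hle, (hC n hn).2.trans hle⟩

/-- The general term of the sum over nonnegative indices. -/
noncomputable def plusTerm (c : FourierCoeffs) (n : ℕ) (τ : ℍ) : ℂ :=
  c.plus n * Complex.exp (2 * Real.pi * Complex.I * (n : ℂ) * (τ : ℂ))

/-- The general term of the sum over negative indices. -/
noncomputable def minusTerm (k : ℤ) (c : FourierCoeffs) (n : ℕ) (τ : ℍ) : ℂ :=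
  c.minus (n + 1)
        * (upperGamma ((1 - k : ℤ) : ℝ) (4 * Real.pi * ((n : ℝ) + 1) * τ.im) : ℂ)
        * Complex.exp (2 * Real.pi * Complex.I * (-((n : ℂ) + 1)) * (τ : ℂ))

lemma toFun_eq (k : ℤ) (c : FourierCoeffs) (τ : ℍ) :
    c.toFun k τ = ∑' n, c.plusTerm n τ + c.minus 0 * ((τ.im ^ (1 - k) : ℝ) : ℂ)
      + ∑' n, c.minusTerm k n τ := rfl

lemma summable_majorant (C : ℝ) (d : ℕ) {r : ℝ} (hr : 0 < r) :
    Summable fun n : ℕ => C * ((n : ℝ) + 1) ^ d * Real.exp (-r * n) := by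
  have h := (summable_nat_add_iff 1).2 (Real.summable_pow_mul_exp_neg_nat_mul d hr)
  refine (h.mul_left (C * Real.exp r)).congr fun n => ?_
  have : Real.exp (-r * n) = Real.exp r * Real.exp (-r * (n + 1)) := by
    rw [← Real.exp_add]; ring_nf
  push_cast
  rw [this]; ring

lemma norm_exp_two_pi_mul (x : ℝ) (τ : ℍ) :
    ‖Complex.exp (2 * Real.pi * Complex.I * (x : ℂ) * (τ : ℂ))‖
      = Real.exp (-(2 * Real.pi * x * τ.im)) := by
  rw [Complex.norm_exp]
  congr 1
  have : 2 * (Real.pi : ℂ) * Complex.I * (x : ℂ) * (τ : ℂ)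
      = ((2 * Real.pi * x : ℝ) : ℂ) * (Complex.I * τ) := by push_cast; ring
  rw [this, Complex.re_ofReal_mul]
  simp

/-- Uniform summable majorants of the two series on a half-plane `im τ ≥ ε`. -/
lemma PolyBounded.exists_majorant (hc : c.PolyBounded) {k : ℤ} (hk : k < 0) {ε : ℝ} (hε : 0 < ε) :
    ∃ u : ℕ → ℝ, Summable u ∧ ∀ n (τ : ℍ), ε ≤ τ.im →
      ‖c.plusTerm n τ‖ ≤ u n ∧ ‖c.minusTerm k n τ‖ ≤ u n := by
  obtain ⟨C, hC0, d, hC⟩ := hc.exists_le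
  have hs : (1 : ℝ) ≤ ((1 - k : ℤ) : ℝ) := by exact_mod_cast (by omega : (1 : ℤ) ≤ 1 - k)
  obtain ⟨G, hG0, hG⟩ := exists_upperGamma_le hs
  have hr : 0 < Real.pi * ε := by positivity
  have hsum := summable_majorant C d hr
  have hsum' := ((summable_nat_add_iff 1).2 hsum).mul_left G
  refine ⟨_, hsum.add hsum', fun n τ hτ => ?_⟩
  have hπ := Real.pi_pos
  have hA : 0 ≤ C * ((n : ℝ) + 1) ^ d * Real.exp (-(Real.pi * ε) * n) := by positivity
  have hB : 0 ≤ G * (C * (((n + 1 : ℕ) : ℝ) + 1) ^ d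
    * Real.exp (-(Real.pi * ε) * ((n + 1 : ℕ) : ℝ))) := by positivity
  constructor
  · refine le_trans ?_ (le_add_of_nonneg_right hB)
    have := norm_exp_two_pi_mul n τ
    rw [Complex.ofReal_natCast] at this
    rw [plusTerm, norm_mul, this]
    refine mul_le_mul (hC n).1 (Real.exp_le_exp.2 ?_) (Real.exp_pos _).le (by positivity)
    have : Real.pi * n * ε ≤ Real.pi * n * τ.im := mul_le_mul_of_nonneg_left hτ (by positivity)
    have h2 : 0 ≤ Real.pi * n * τ.im := by have := τ.im_pos; positivity
    nlinarith
  · refine le_trans ?_ (le_add_of_nonneg_left hA)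
    have h1 := norm_exp_two_pi_mul (-((n : ℝ) + 1)) τ
    push_cast at h1
    have hx : 0 ≤ 4 * Real.pi * ((n : ℝ) + 1) * τ.im := by have := τ.im_pos; positivity
    rw [minusTerm, norm_mul, norm_mul, h1, Complex.norm_real, Real.norm_of_nonneg
      (upperGamma_nonneg _ hx)]
    calc _ ≤ (C * (((n + 1 : ℕ) : ℝ) + 1) ^ d)
          * (G * Real.exp (-(3 / 4) * (4 * Real.pi * ((n : ℝ) + 1) * τ.im)))
          * Real.exp (-(2 * Real.pi * (-((n : ℝ) + 1)) * τ.im)) := by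
          gcongr
          · exact upperGamma_nonneg _ hx
          · exact (hC (n + 1)).2
          · exact hG _ hx
      _ = G * (C * (((n + 1 : ℕ) : ℝ) + 1) ^ d
          * Real.exp (-(Real.pi * τ.im) * ((n + 1 : ℕ) : ℝ))) := by
          -- The decay e^{-3π(n+1)v} of the gamma factor against the growth e^{2π(n+1)v} of the
          -- exponential leaves e^{-π(n+1)v}.
          have : Real.exp (-(Real.pi * τ.im) * ((n + 1 : ℕ) : ℝ))
            = Real.exp (-(3 / 4) * (4 * Real.pi * ((n : ℝ) + 1) * τ.im))
              * Real.exp (-(2 * Real.pi * (-((n : ℝ) + 1)) * τ.im)) := by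
            rw [← Real.exp_add]; push_cast; ring_nf
          rw [this]; ring
      _ ≤ _ := by gcongr

lemma PolyBounded.summable_plusTerm (hc : c.PolyBounded) {k : ℤ} (hk : k < 0) (τ : ℍ) :
    Summable fun n => c.plusTerm n τ := by
  obtain ⟨u, hu, h⟩ := hc.exists_majorant hk τ.im_pos
  exact hu.of_norm_bounded fun n => (h n τ le_rfl).1

lemma PolyBounded.summable_minusTerm (hc : c.PolyBounded) {k : ℤ} (hk : k < 0) (τ : ℍ) :
    Summable fun n => c.minusTerm k n τ := by
  obtain ⟨u, hu, h⟩ := hc.exists_majorant hk τ.im_pos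
  exact hu.of_norm_bounded fun n => (h n τ le_rfl).2

lemma continuous_plusTerm (c : FourierCoeffs) (n : ℕ) : Continuous (c.plusTerm n) := by
  unfold plusTerm
  fun_prop

lemma continuous_minusTerm {k : ℤ} (hk : k < 0) (c : FourierCoeffs) (n : ℕ) :
    Continuous (c.minusTerm k n) := by
  have hs : (1 : ℝ) ≤ ((1 - k : ℤ) : ℝ) := by exact_mod_cast (by omega : (1 : ℤ) ≤ 1 - k)
  have hg : Continuous fun τ : ℍ =>
      upperGamma ((1 - k : ℤ) : ℝ) (4 * Real.pi * ((n : ℝ) + 1) * τ.im) := by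
    refine (continuousOn_upperGamma hs).comp_continuous (by fun_prop) fun τ => ?_
    have := τ.im_pos
    have := Real.pi_pos
    exact Set.mem_Ici.2 (by positivity)
  unfold minusTerm
  fun_prop

/-- The function attached to polynomially bounded coefficients is continuous. -/
lemma PolyBounded.continuous_toFun (hc : c.PolyBounded) {k : ℤ} (hk : k < 0) :
    Continuous (c.toFun k) := by
  refine continuous_iff_continuousAt.2 fun τ₀ => ?_
  obtain ⟨u, hu, h⟩ := hc.exists_majorant hk (half_pos τ₀.im_pos)
  have hopen : IsOpen {τ : ℍ | τ₀.im / 2 < τ.im} := isOpen_lt continuous_const continuous_im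
  have hmem : {τ : ℍ | τ₀.im / 2 < τ.im} ∈ nhds τ₀ := hopen.mem_nhds (half_lt_self τ₀.im_pos)
  refine ContinuousOn.continuousAt ?_ hmem
  refine ContinuousOn.congr (f := fun τ => ∑' n, c.plusTerm n τ
    + c.minus 0 * ((τ.im ^ (1 - k) : ℝ) : ℂ) + ∑' n, c.minusTerm k n τ) ?_
    fun τ _ => toFun_eq k c τ
  refine ((continuousOn_tsum (fun n => (c.continuous_plusTerm n).continuousOn) hu
    fun n τ hτ => (h n τ (le_of_lt hτ)).1).add (Continuous.continuousOn ?_)).add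
    (continuousOn_tsum (fun n => (c.continuous_minusTerm hk n).continuousOn) hu
    fun n τ hτ => (h n τ (le_of_lt hτ)).2)
  refine continuous_const.mul (Complex.continuous_ofReal.comp ?_)
  exact continuous_im.zpow₀ _ fun τ => Or.inl τ.im_ne_zero

/-- A finite linear combination of real translates of the series multiplies each coefficient by
the corresponding exponential sum. -/
lemma PolyBounded.sum_translate (hc : c.PolyBounded) {k : ℤ} (hk : k < 0) {ι : Type*}
    (s : Finset ι) (w : ι → ℂ) (x : ι → ℝ) (τ : ℍ) :
    ∑ i ∈ s, w i * c.toFun k (x i +ᵥ τ) = toFun k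
      ⟨fun n => (∑ i ∈ s, w i * Complex.exp (2 * Real.pi * Complex.I * (n * x i))) * c.plus n,
       fun n => (∑ i ∈ s, w i * Complex.exp (2 * Real.pi * Complex.I * (-n * x i))) * c.minus n⟩
      τ := by
  have hp : ∀ i n, w i * c.plusTerm n (x i +ᵥ τ)
      = w i * Complex.exp (2 * Real.pi * Complex.I * (n * x i)) * c.plusTerm n τ := by
    intro i n
    simp only [plusTerm, coe_vadd]
    have : Complex.exp (2 * Real.pi * Complex.I * n * (x i + τ))
      = Complex.exp (2 * Real.pi * Complex.I * (n * x i))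
        * Complex.exp (2 * Real.pi * Complex.I * n * τ) := by
      rw [← Complex.exp_add]; ring_nf
    rw [this]; ring
  have hm : ∀ i n, w i * c.minusTerm k n (x i +ᵥ τ)
      = w i * Complex.exp (2 * Real.pi * Complex.I * (-(n + 1 : ℕ) * x i))
        * c.minusTerm k n τ := by
    intro i n
    simp only [minusTerm, coe_vadd, vadd_im]
    have : Complex.exp (2 * Real.pi * Complex.I * (-((n : ℂ) + 1)) * (x i + τ))
      = Complex.exp (2 * Real.pi * Complex.I * (-(n + 1 : ℕ) * x i))
        * Complex.exp (2 * Real.pi * Complex.I * (-((n : ℂ) + 1)) * τ) := by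
      rw [← Complex.exp_add]; push_cast; ring_nf
    rw [this]; ring
  simp only [toFun_eq, mul_add, Finset.sum_add_distrib, ← tsum_mul_left]
  rw [← Summable.tsum_finsetSum fun i _ => (hc.summable_plusTerm hk _).mul_left _,
    ← Summable.tsum_finsetSum fun i _ => (hc.summable_minusTerm hk _).mul_left _]
  simp only [hp, hm, ← Finset.sum_mul]
  congr 1
  · congr 1
    · exact tsum_congr fun n => by simp only [plusTerm]; ring
    · simp [← mul_assoc, Finset.sum_mul]
  · exact tsum_congr fun n => by simp only [minusTerm]; ring

lemma PolyBounded.toFun_one_vadd (hc : c.PolyBounded) {k : ℤ} (hk : k < 0) (τ : ℍ) :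
    c.toFun k ((1 : ℝ) +ᵥ τ) = c.toFun k τ := by
  have h := hc.sum_translate hk {()} (fun _ => 1) (fun _ => 1) τ
  have e1 : ∀ n : ℕ, Complex.exp (2 * Real.pi * Complex.I * n) = 1 := fun n => by
    rw [mul_comm]; exact Complex.exp_nat_mul_two_pi_mul_I n
  have e2 : ∀ n : ℕ, Complex.exp (-(2 * Real.pi * Complex.I * n)) = 1 := fun n => by
    rw [Complex.exp_neg, e1, inv_one]
  simpa [e1, e2] using h

/-- The twist by a primitive character as a combination of translates. -/
lemma PolyBounded.gaussSum_mul_toFun_twist (hc : c.PolyBounded) {k : ℤ} (hk : k < 0) {M : ℕ}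
    [NeZero M] {ψ : DirichletCharacter ℂ M} (hψ : (star ψ).IsPrimitive) (τ : ℍ) :
    dirichletGaussSum (star ψ) * (c.twist ψ).toFun k τ
      = ∑ a : ZMod M, star ψ a * c.toFun k (((a.val : ℝ) / M) +ᵥ τ) := by
  -- Separability of the Gauss sum; primitivity makes it hold also for n not coprime to M, where
  -- both sides vanish.
  have key : ∀ n : ℤ, ∑ a : ZMod M, star ψ a
      * Complex.exp (2 * Real.pi * Complex.I * (n * ((a.val : ℝ) / M : ℝ)))
      = dirichletGaussSum (star ψ) * ψ (n : ZMod M) := by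
    intro n
    have h := gaussSum_mulShift_of_isPrimitive (ZMod.stdAddChar (N := M)) hψ (n : ZMod M)
    have hinv : (star ψ)⁻¹ = ψ := by rw [MulChar.star_eq_inv, inv_inv]
    rw [hinv] at h
    rw [dirichletGaussSum, mul_comm (gaussSum _ _), ← h, gaussSum]
    refine Finset.sum_congr rfl fun a _ => ?_
    congr 1
    have : (n : ZMod M) * a = ((n * (a.val : ℤ) : ℤ) : ZMod M) := by
      push_cast; rw [ZMod.natCast_zmod_val]
    rw [AddChar.mulShift_apply, this, ZMod.stdAddChar_coe]
    congr 1
    push_cast; ring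
  have h := hc.sum_translate hk Finset.univ (fun a : ZMod M => star ψ a)
    (fun a => (a.val : ℝ) / M) τ
  have hp (n : ℕ) : ∑ a : ZMod M, star ψ a
      * Complex.exp (2 * Real.pi * Complex.I * (n * ((a.val : ℝ) / M : ℝ)))
      = dirichletGaussSum (star ψ) * ψ (n : ZMod M) := mod_cast key n
  have hm (n : ℕ) : ∑ a : ZMod M, star ψ a
      * Complex.exp (2 * Real.pi * Complex.I * (-n * ((a.val : ℝ) / M : ℝ)))
      = dirichletGaussSum (star ψ) * ψ (-(n : ZMod M)) := by
    have h := key (-n)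
    push_cast at h ⊢
    exact h
  simp only [hp, hm] at h
  rw [h]
  simp only [toFun, twist, mul_add, ← tsum_mul_left]
  congr 1
  · congr 1
    · exact tsum_congr fun n => by ring
    · simp only [mul_assoc]
  · exact tsum_congr fun n => by push_cast; ring

end FourierCoeffs

/-! ### The slash operator on GL(2, ℝ)⁺. -/

section Slash

lemma glPos_det_pos (A : GL(2, ℝ)⁺) : 0 < (A : GL (Fin 2) ℝ).det.val := A.2

lemma slashOp_mul (k : ℤ) (F : ℍ → ℂ) (A B : GL(2, ℝ)⁺) :
    slashOp k F (A * B) = slashOp k (slashOp k F A) B := by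
  funext τ
  have hA : 0 < (A : GL (Fin 2) ℝ).1.det := A.2
  have hB : 0 < (B : GL (Fin 2) ℝ).1.det := B.2
  have hden : denom ((A : GL (Fin 2) ℝ) * (B : GL (Fin 2) ℝ)) τ
      = denom (A : GL (Fin 2) ℝ) ((B : GL (Fin 2) ℝ) • τ : ℍ) * denom (B : GL (Fin 2) ℝ) τ := by
    rw [denom_cocycle _ _ τ.im_ne_zero, coe_smul_of_det_pos (glPos_det_pos B)]
  simp only [slashOp, Subgroup.coe_mul, mul_smul, hden, Units.val_mul, Matrix.det_mul,
    Real.mul_rpow hA.le hB.le, mul_zpow, Complex.ofReal_mul]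
  ring

@[simp]
lemma slashOp_one (k : ℤ) (F : ℍ → ℂ) : slashOp k F 1 = F := by
  funext τ
  simp [slashOp]

lemma slashOp_smul (k : ℤ) (a : ℂ) (F : ℍ → ℂ) (A : GL(2, ℝ)⁺) :
    slashOp k (a • F) A = a • slashOp k F A := by
  funext τ
  simp only [slashOp, Pi.smul_apply, smul_eq_mul]
  ring

lemma slashOp_sub (k : ℤ) (F G : ℍ → ℂ) (A : GL(2, ℝ)⁺) :
    slashOp k (F - G) A = slashOp k F A - slashOp k G A := by
  funext τ
  simp only [slashOp, Pi.sub_apply]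
  ring

lemma slashOp_sum (k : ℤ) {ι : Type*} (s : Finset ι) (F : ι → ℍ → ℂ) (A : GL(2, ℝ)⁺) :
    slashOp k (∑ i ∈ s, F i) A = ∑ i ∈ s, slashOp k (F i) A := by
  funext τ
  simp only [slashOp, Finset.sum_apply, Finset.mul_sum]

/-- Positive scalar multiples act in the same way. -/
lemma slashOp_eq_of_smul (k : ℤ) (F : ℍ → ℂ) {A B : GL(2, ℝ)⁺} {r : ℝ} (hr : 0 < r)
    (h : (A : GL (Fin 2) ℝ).1 = r • (B : GL (Fin 2) ℝ).1) :
    slashOp k F A = slashOp k F B := by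
  funext τ
  have hB : 0 < (B : GL (Fin 2) ℝ).1.det := B.2
  have hdet : (A : GL (Fin 2) ℝ).1.det = r ^ 2 * (B : GL (Fin 2) ℝ).1.det := by
    rw [h, Matrix.det_smul, Fintype.card_fin]
  have hden : denom (A : GL (Fin 2) ℝ) τ = r * denom (B : GL (Fin 2) ℝ) τ := by
    simp only [denom, h, Matrix.smul_apply, smul_eq_mul]; push_cast; ring
  have hnum : num (A : GL (Fin 2) ℝ) τ = r * num (B : GL (Fin 2) ℝ) τ := by
    simp only [num, h, Matrix.smul_apply, smul_eq_mul]; push_cast; ring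
  have hr' : (r : ℂ) ≠ 0 := by exact_mod_cast hr.ne'
  have hact : (A : GL (Fin 2) ℝ) • τ = (B : GL (Fin 2) ℝ) • τ := by
    apply UpperHalfPlane.ext
    rw [coe_smul_of_det_pos (glPos_det_pos A), coe_smul_of_det_pos (glPos_det_pos B), hden, hnum,
      mul_div_mul_left _ _ hr']
  have hpow : (r ^ 2) ^ ((k : ℝ) / 2) = r ^ k := by
    rw [← Real.rpow_natCast, ← Real.rpow_mul hr.le, ← Real.rpow_intCast]
    congr 1; push_cast; ring
  simp only [slashOp, hact, hden, hdet, mul_zpow, Real.mul_rpow (sq_nonneg r) hB.le, hpow]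
  push_cast
  rw [zpow_neg (r : ℂ)]
  field_simp

/-- The element of `GL(2, ℝ)⁺` with given entries and positive determinant. -/
noncomputable def glPosMk (a b c d : ℝ) (h : 0 < a * d - b * c) : GL(2, ℝ)⁺ :=
  ⟨Matrix.GeneralLinearGroup.mkOfDetNeZero !![a, b; c, d]
      (by rw [Matrix.det_fin_two_of]; exact h.ne'),
    by
      change 0 < (!![a, b; c, d]).det
      rwa [Matrix.det_fin_two_of]⟩

@[simp]
lemma coe_frickeMatrix (M : ℕ) [NeZero M] :
    (frickeMatrix M : GL (Fin 2) ℝ).1 = !![0, -1; (M : ℝ), 0] := rfl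

lemma glPos_ext {A B : GL(2, ℝ)⁺} (h : (A : GL (Fin 2) ℝ).1 = (B : GL (Fin 2) ℝ).1) : A = B :=
  Subtype.ext (Units.ext h)

/-- The translation matrix `(1, x; 0, 1)`. -/
noncomputable def shiftMatrix (x : ℝ) : GL(2, ℝ)⁺ := glPosMk 1 x 0 1 (by norm_num)

@[simp]
lemma coe_shiftMatrix (x : ℝ) : (shiftMatrix x : GL (Fin 2) ℝ).1 = !![1, x; 0, 1] := rfl

lemma shiftMatrix_add (x y : ℝ) : shiftMatrix (x + y) = shiftMatrix x * shiftMatrix y := by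
  apply glPos_ext
  rw [Subgroup.coe_mul, Units.val_mul]
  simp [add_comm]

lemma slashOp_shiftMatrix (k : ℤ) (F : ℍ → ℂ) (x : ℝ) (τ : ℍ) :
    slashOp k F (shiftMatrix x) τ = F (x +ᵥ τ) := by
  have hden : denom (shiftMatrix x : GL (Fin 2) ℝ) τ = 1 := by simp [denom]
  have hact : (shiftMatrix x : GL (Fin 2) ℝ) • τ = x +ᵥ τ := by
    apply UpperHalfPlane.ext
    rw [coe_smul_of_det_pos (glPos_det_pos _), hden]
    simp [num, add_comm]
  rw [slashOp, hact, hden]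
  simp

lemma continuous_slashOp (k : ℤ) {F : ℍ → ℂ} (hF : Continuous F) (A : GL(2, ℝ)⁺) :
    Continuous (slashOp k F A) := by
  have h1 : Continuous fun τ : ℍ => denom (A : GL (Fin 2) ℝ) τ := by
    unfold denom; fun_prop
  have h2 : Continuous fun τ : ℍ => (A : GL (Fin 2) ℝ) • τ := continuous_const_smul _
  exact (continuous_const.mul (h1.zpow₀ _ fun τ => Or.inl (denom_ne_zero _ τ))).mul (hF.comp h2)

/-- Invariance under integral translations. -/
lemma slashOp_shiftMatrix_int {k : ℤ} {F : ℍ → ℂ}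
    (hF : slashOp k F (shiftMatrix 1) = F) (a : ℤ) : slashOp k F (shiftMatrix a) = F := by
  have hinv : slashOp k F (shiftMatrix (-1)) = F := by
    conv_lhs => rw [← hF, ← slashOp_mul, ← shiftMatrix_add]
    funext τ
    simp [slashOp_shiftMatrix]
  induction a using Int.induction_on with
  | zero => funext τ; simp [slashOp_shiftMatrix]
  | succ n ih =>
    push_cast at ih ⊢
    rw [shiftMatrix_add, slashOp_mul, ih, hF]
  | pred n ih =>
    push_cast at ih ⊢
    rw [sub_eq_add_neg, shiftMatrix_add, slashOp_mul, ih, hinv]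

end Slash

/-! ### Hyperbolic circles about two centres. -/

section HyperbolicSpheres

open Real Metric

/-- The points above and below the centre of a hyperbolic circle: one of them is far from `b`. -/
lemma exists_dist_eq_cosh_mul_le (a b : ℍ) {r : ℝ} (hr : 0 ≤ r) :
    ∃ p : ℍ, dist p a = r ∧ cosh r * cosh (dist a b) ≤ cosh (dist p b) := by
  have ha := a.im_pos
  have hb := b.im_pos
  let P (s : ℝ) : ℍ := ⟨⟨a.re, a.im * exp s⟩, mul_pos ha (exp_pos s)⟩
  have hPre (s : ℝ) : (P s).re = a.re := rfl
  have hPim (s : ℝ) : (P s).im = a.im * exp s := rfl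
  have hd (s : ℝ) : dist (P s) a = |s| := by
    rw [dist_of_re_eq (hPre s), hPim, log_mul ha.ne' (exp_pos s).ne', log_exp, Real.dist_eq]
    congr 1; ring
  by_contra! hcon
  have h1 := hcon (P r) (by rw [hd, abs_of_nonneg hr])
  have h2 := hcon (P (-r)) (by rw [hd, abs_neg, abs_of_nonneg hr])
  -- The two values average exactly to the claimed bound, so one of them reaches it.
  have hsum : cosh (dist (P r) b) + cosh (dist (P (-r)) b) = 2 * (cosh r * cosh (dist a b)) := by
    rw [cosh_dist', cosh_dist', cosh_dist', hPre, hPre, hPim, hPim, cosh_eq r, exp_neg]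
    have := exp_pos r
    field_simp
    ring
  linarith

lemma isPreconnected_hyperbolic_closedBall (a : ℍ) (r : ℝ) : IsPreconnected (closedBall a r) := by
  rw [← isEmbedding_coe.isInducing.isPreconnected_image, image_coe_closedBall]
  exact (convex_closedBall _ _).isPreconnected

lemma isPreconnected_hyperbolic_sphere (a : ℍ) (r : ℝ) : IsPreconnected (sphere a r) := by
  rw [← isEmbedding_coe.isInducing.isPreconnected_image, image_coe_sphere]
  exact isPreconnected_sphere (by rw [Complex.rank_real_complex]; norm_num) _ _

lemma exists_mem_dist_eq {S : Set ℍ} (hS : IsPreconnected S) (b : ℍ) {p q : ℍ} (hp : p ∈ S)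
    (hq : q ∈ S) {t : ℝ} (h1 : dist p b ≤ t) (h2 : t ≤ dist q b) : ∃ x ∈ S, dist x b = t :=
  hS.intermediate_value hp hq (f := fun x => dist x b) (by fun_prop) ⟨h1, h2⟩

/-- A set which is a union of spheres around `a`, and also a union of spheres around `b ≠ a`,
contains everything as soon as it contains `a`. -/
theorem mem_of_dist_invariant {a b : ℍ} (hab : a ≠ b) {Z : Set ℍ} (ha : a ∈ Z)
    (hA : ∀ z w, dist z a = dist w a → z ∈ Z → w ∈ Z)
    (hB : ∀ z w, dist z b = dist w b → z ∈ Z → w ∈ Z) (z : ℍ) : z ∈ Z := by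
  set D := dist a b with hD
  have hD0 : 0 < D := dist_pos.2 hab
  have hone : 1 < cosh D := one_lt_cosh.2 hD0.ne'
  have habs : ∀ {x y : ℝ}, 0 ≤ x → 0 ≤ y → cosh x ≤ cosh y → x ≤ y := fun hx hy h => by
    rwa [cosh_le_cosh, abs_of_nonneg hx, abs_of_nonneg hy] at h
  -- The circle about b through a lies in Z. On it the distance to a takes every value from 0 to at
  -- least D, so Z contains each circle about a of radius at most D.
  have h0 : closedBall a D ⊆ Z := by
    intro w hw
    obtain ⟨p, hpb, hpa⟩ := exists_dist_eq_cosh_mul_le b a hD0.le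
    rw [dist_comm b a, ← hD] at hpa
    have hpD : D ≤ dist p a := habs hD0.le dist_nonneg (by nlinarith)
    obtain ⟨x, hx, hxw⟩ := exists_mem_dist_eq (isPreconnected_hyperbolic_sphere b D) a
      (p := a) (q := p) (t := dist w a) hD.symm hpb (by simp) (le_trans hw hpD)
    have hx' : dist a b = dist x b := (mem_sphere.1 hx).symm ▸ hD.symm
    exact hA _ _ hxw (hB _ _ hx' ha)
  -- A ball about one centre that contains the other centre yields a ball about the latter, with
  -- cosh of the radius larger by a factor up to cosh D.
  have step : ∀ {a b : ℍ}, (∀ z w, dist z b = dist w b → z ∈ Z → w ∈ Z) → dist a b = D →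
      ∀ {R R' : ℝ}, D ≤ R → closedBall a R ⊆ Z → cosh R' ≤ cosh R * cosh D → 0 ≤ R' →
        closedBall b R' ⊆ Z := by
    intro a b hB hab R R' hDR hR hR' hR'0 w hw
    obtain ⟨p, hpa, hpb⟩ := exists_dist_eq_cosh_mul_le a b (hD0.le.trans hDR)
    rw [hab] at hpb
    have hpR : R' ≤ dist p b := habs hR'0 dist_nonneg (hR'.trans hpb)
    obtain ⟨x, hx, hxw⟩ := exists_mem_dist_eq (isPreconnected_hyperbolic_closedBall a R) b
      (p := b) (q := p) (t := dist w b) (by rw [mem_closedBall, dist_comm, hab]; exact hDR)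
      hpa.le (by simp) (le_trans hw hpR)
    exact hB _ _ hxw (hR hx)
  have key : ∀ n : ℕ, ∀ R : ℝ, 0 ≤ R → cosh R ≤ cosh D ^ (n + 1) → closedBall a R ⊆ Z := by
    intro n
    induction n with
    | zero =>
      intro R hR hRD
      rw [zero_add, pow_one] at hRD
      exact (closedBall_subset_closedBall (habs hR hD0.le hRD)).trans h0
    | succ n ih =>
      intro R hR hRD
      have hX : 1 ≤ cosh D ^ (n + 1) := one_le_pow₀ hone.le
      have hch : cosh (arcosh (cosh D ^ (n + 1))) = cosh D ^ (n + 1) := cosh_arcosh hX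
      have hDR : D ≤ arcosh (cosh D ^ (n + 1)) :=
        habs hD0.le (arcosh_nonneg hX) (by rw [hch]; exact le_self_pow₀ hone.le (by omega))
      -- Move to centre b without enlarging the radius, then back to a gaining the factor cosh D.
      have h1 := step hB hD.symm hDR (ih _ (arcosh_nonneg hX) hch.le) (R' := arcosh _)
        (by nlinarith) (arcosh_nonneg hX)
      exact step hA (by rw [dist_comm]) hDR h1 (by rw [hch, ← pow_succ]; exact hRD) hR
  obtain ⟨n, hn⟩ := pow_unbounded_of_one_lt (cosh (dist z a)) hone
  exact key n _ dist_nonneg (hn.le.trans (pow_le_pow_right₀ hone.le n.le_succ)) (by simp)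

end HyperbolicSpheres

/-! ### Elliptic elements as rotations in the disc model. -/

section Rotations

open ComplexConjugate

/-- The Cayley coordinate centred at `a`. -/
noncomputable def cayley (a z : ℂ) : ℂ := (z - a) / (z - conj a)

lemma coe_sub_conj_ne_zero (a z : ℍ) : (z : ℂ) - conj (a : ℂ) ≠ 0 := by
  intro h
  have := congrArg Complex.im h
  simp only [Complex.sub_im, Complex.conj_im, Complex.zero_im, coe_im] at this
  linarith [a.im_pos, z.im_pos]

lemma norm_cayley (a z : ℍ) : ‖cayley a z‖ = Real.tanh (dist z a / 2) := by
  rw [tanh_half_dist, cayley, norm_div, Complex.dist_eq, Complex.dist_eq]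

lemma norm_cayley_lt_one (a z : ℍ) : ‖cayley a z‖ < 1 := by
  rw [norm_cayley]; exact Real.tanh_lt_one _

lemma cayley_eq_zero_iff (a z : ℍ) : cayley a z = 0 ↔ z = a := by
  rw [cayley, div_eq_zero_iff, or_iff_left (coe_sub_conj_ne_zero a z), sub_eq_zero]
  exact ⟨fun h => UpperHalfPlane.ext h, fun h => h ▸ rfl⟩

lemma one_sub_ne_zero_of_norm_lt_one {w : ℂ} (hw : ‖w‖ < 1) : 1 - w ≠ 0 := by
  intro h
  rw [← sub_eq_zero.1 h, norm_one] at hw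
  exact lt_irrefl _ hw

lemma cayley_inverse_im_pos (a : ℍ) {w : ℂ} (hw : ‖w‖ < 1) :
    0 < ((a - conj (a : ℂ) * w) / (1 - w)).im := by
  have h1 : 0 < Complex.normSq (1 - w) :=
    Complex.normSq_pos.2 (one_sub_ne_zero_of_norm_lt_one hw)
  have h2 : 0 < 1 - Complex.normSq w := by
    rw [Complex.normSq_eq_norm_sq]
    nlinarith [norm_nonneg w]
  have key : ((a - conj (a : ℂ) * w) / (1 - w)).im
      = a.im * (1 - Complex.normSq w) / Complex.normSq (1 - w) := by
    rw [Complex.div_im, ← sub_div]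
    congr 1
    simp only [Complex.normSq_apply, Complex.sub_re, Complex.sub_im, Complex.mul_re,
      Complex.mul_im, Complex.conj_re, Complex.conj_im, Complex.one_re, Complex.one_im,
      coe_re, coe_im]
    ring
  rw [key]
  exact div_pos (mul_pos a.im_pos h2) h1

/-- The inverse of the Cayley coordinate centred at `a`. -/
noncomputable def cayleyInv (a : ℍ) (w : ℂ) (hw : ‖w‖ < 1) : ℍ :=
  ⟨(a - conj (a : ℂ) * w) / (1 - w), cayley_inverse_im_pos a hw⟩

lemma cayleyInv_eq (a z : ℍ) {w : ℂ} (hw : ‖w‖ < 1) (h : cayley a z = w) :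
    cayleyInv a w hw = z := by
  apply UpperHalfPlane.ext
  change ((a : ℂ) - conj (a : ℂ) * w) / (1 - w) = z
  rw [div_eq_iff (one_sub_ne_zero_of_norm_lt_one hw), ← h, cayley]
  have := coe_sub_conj_ne_zero a z
  field_simp
  ring

lemma cayley_cayleyInv (a : ℍ) {w : ℂ} (hw : ‖w‖ < 1) : cayley a (cayleyInv a w hw) = w := by
  have hne := one_sub_ne_zero_of_norm_lt_one hw
  have hcoe : (cayleyInv a w hw : ℂ) = (a - conj (a : ℂ) * w) / (1 - w) := rfl
  rw [cayley, div_eq_iff (coe_sub_conj_ne_zero a (cayleyInv a w hw)), hcoe]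
  field_simp
  ring

/-- Transport to ℝ/2πℤ, where an element of infinite order generates a dense subgroup. -/
lemma denseRange_zpow_circle {μ : Circle} (hμ : ∀ n : ℕ, 0 < n → μ ^ n ≠ 1) :
    DenseRange fun n : ℤ => μ ^ n := by
  have : Fact (0 < 2 * Real.pi) := ⟨Real.two_pi_pos⟩
  have hT : 2 * Real.pi ≠ 0 := Real.two_pi_pos.ne'
  obtain ⟨x, rfl⟩ := (AddCircle.homeomorphCircle hT).surjective μ
  simp only [AddCircle.homeomorphCircle_apply] at hμ ⊢
  have hx : addOrderOf x = 0 := by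
    rw [addOrderOf_eq_zero_iff']
    intro n hn h
    exact hμ n hn (by rw [← AddCircle.toCircle_nsmul, h, AddCircle.toCircle_zero])
  have h := (AddCircle.homeomorphCircle hT).surjective.denseRange.comp
    (AddCircle.denseRange_zsmul_iff.2 hx) (AddCircle.homeomorphCircle hT).continuous
  refine (congrArg DenseRange (funext fun n : ℤ => ?_)).mp h
  simp [AddCircle.homeomorphCircle_apply, AddCircle.toCircle_zsmul]

variable {A : GL(2, ℝ)⁺} {a : ℍ}

lemma num_eq_of_fixed (ha : (A : GL (Fin 2) ℝ) • a = a) :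
    num (A : GL (Fin 2) ℝ) a = a * denom (A : GL (Fin 2) ℝ) a := by
  have h := congrArg ((↑) : ℍ → ℂ) ha
  rwa [coe_smul_of_det_pos (glPos_det_pos A), div_eq_iff (denom_ne_zero _ a)] at h

/-- Compare imaginary parts: Im(Aa) = Im(a)/|j|², where j is the automorphy factor at a. -/
lemma norm_denom_of_fixed (hA : (A : GL (Fin 2) ℝ).1.det = 1)
    (ha : (A : GL (Fin 2) ℝ) • a = a) : ‖denom (A : GL (Fin 2) ℝ) a‖ = 1 := by
  have h := im_smul_eq_div_normSq (A : GL (Fin 2) ℝ) a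
  have hdet : (A : GL (Fin 2) ℝ).det.val = 1 := hA
  rw [ha, hdet, abs_one, one_mul, eq_div_iff (normSq_denom_ne_zero _ a.im_ne_zero)] at h
  have h1 : Complex.normSq (denom (A : GL (Fin 2) ℝ) a) = 1 :=
    mul_left_cancel₀ a.im_ne_zero (by rw [h, mul_one])
  rw [Complex.normSq_eq_norm_sq] at h1
  exact (pow_eq_one_iff_of_nonneg (norm_nonneg _) two_ne_zero).1 h1

/-- In the Cayley coordinate, a matrix fixing the centre acts as a rotation. -/
lemma cayley_smul (hA : (A : GL (Fin 2) ℝ).1.det = 1) (ha : (A : GL (Fin 2) ℝ) • a = a) (z : ℍ) :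
    cayley a ((A : GL (Fin 2) ℝ) • z : ℍ)
      = conj (denom (A : GL (Fin 2) ℝ) a) / denom (A : GL (Fin 2) ℝ) a * cayley a z := by
  have hj := denom_ne_zero (A : GL (Fin 2) ℝ) a
  have hj' : conj (denom (A : GL (Fin 2) ℝ) a) ≠ 0 := (map_ne_zero _).2 hj
  have hz := denom_ne_zero (A : GL (Fin 2) ℝ) z
  have hfix := num_eq_of_fixed ha
  have hfix' := congrArg conj hfix
  rw [coe_smul_of_det_pos (glPos_det_pos A)]
  have hdet : ((A : GL (Fin 2) ℝ) 0 0 : ℂ) * ((A : GL (Fin 2) ℝ) 1 1 : ℂ)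
      - ((A : GL (Fin 2) ℝ) 0 1 : ℂ) * ((A : GL (Fin 2) ℝ) 1 0 : ℂ) = 1 := by
    rw [Matrix.det_fin_two] at hA
    exact_mod_cast hA
  have e1 : (num (A : GL (Fin 2) ℝ) z / denom (A : GL (Fin 2) ℝ) z - a)
      * (denom (A : GL (Fin 2) ℝ) z * denom (A : GL (Fin 2) ℝ) a) = z - a := by
    rw [sub_mul, ← mul_assoc, div_mul_cancel₀ _ hz]
    simp only [num, denom] at hfix ⊢
    linear_combination (z - (a : ℂ)) * hdet
      + (((A : GL (Fin 2) ℝ) 1 0 : ℂ) * z + ((A : GL (Fin 2) ℝ) 1 1 : ℂ)) * hfix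
  have e2 : (num (A : GL (Fin 2) ℝ) z / denom (A : GL (Fin 2) ℝ) z - conj (a : ℂ))
      * (denom (A : GL (Fin 2) ℝ) z * conj (denom (A : GL (Fin 2) ℝ) a)) = z - conj (a : ℂ) := by
    rw [sub_mul, ← mul_assoc, div_mul_cancel₀ _ hz]
    simp only [num, denom, map_add, map_mul, Complex.conj_ofReal] at hfix' ⊢
    linear_combination (z - conj (a : ℂ)) * hdet
      + (((A : GL (Fin 2) ℝ) 1 0 : ℂ) * z + ((A : GL (Fin 2) ℝ) 1 1 : ℂ)) * hfix'
  rw [cayley, cayley, ← e1, ← e2]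
  field_simp

/-- Zero sets of continuous functions invariant under an elliptic element of infinite order are
unions of spheres around the fixed point. -/
lemma eq_zero_of_dist_eq {k : ℤ} {h : ℍ → ℂ} (hc : Continuous h)
    (hA : (A : GL (Fin 2) ℝ).1.det = 1) (ha : (A : GL (Fin 2) ℝ) • a = a)
    (hj : ∀ n : ℕ, 0 < n → denom (A : GL (Fin 2) ℝ) a ^ n ≠ 1) (hh : slashOp k h A = h)
    {z w : ℍ} (hzw : dist z a = dist w a) (hz : h z = 0) : h w = 0 := by
  have hj0 := denom_ne_zero (A : GL (Fin 2) ℝ) a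
  have hzero : ∀ x : ℍ, h ((A : GL (Fin 2) ℝ) • x) = 0 ↔ h x = 0 := by
    intro x
    have hx := congrFun hh x
    rw [slashOp] at hx
    have h1 : denom (A : GL (Fin 2) ℝ) x ^ (-k) ≠ 0 := zpow_ne_zero _ (denom_ne_zero _ x)
    rw [← hx, hA, Real.one_rpow, Complex.ofReal_one, one_mul, mul_eq_zero, or_iff_right h1]
  by_cases hza : z = a
  · rw [hza, dist_self, eq_comm, dist_eq_zero] at hzw
    rwa [hzw, ← hza]
  have hcz : cayley a z ≠ 0 := fun h0 => hza ((cayley_eq_zero_iff a z).1 h0)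
  set μ : Circle := Circle.ofConjDivSelf _ hj0
  have hμ : (μ : ℂ) = conj (denom (A : GL (Fin 2) ℝ) a) / denom (A : GL (Fin 2) ℝ) a := rfl
  have hμn : ∀ n : ℕ, 0 < n → μ ^ n ≠ 1 := by
    intro n hn h1
    -- The rotation multiplier is j̄/j = j^{-2} because |j| = 1, so μ^n = 1 means j^{2n} = 1.
    refine hj (2 * n) (by omega) ?_
    have h2 : (μ : ℂ) ^ n = 1 := by exact_mod_cast congrArg ((↑) : Circle → ℂ) h1
    have h3 : conj (denom (A : GL (Fin 2) ℝ) a) * denom (A : GL (Fin 2) ℝ) a = 1 := by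
      rw [mul_comm, Complex.mul_conj, Complex.normSq_eq_norm_sq, norm_denom_of_fixed hA ha]
      simp
    rw [hμ, div_pow, div_eq_one_iff_eq (pow_ne_zero _ hj0)] at h2
    have h4 := congrArg (· ^ n) h3
    simp only [mul_pow, one_pow, h2] at h4
    rw [← h4]; ring
  have hlt : ∀ ν : Circle, ‖(ν : ℂ) * cayley a z‖ < 1 := fun ν => by
    rw [norm_mul, Circle.norm_coe, one_mul]; exact norm_cayley_lt_one a z
  have hcontM : Continuous fun ν : Circle => cayleyInv a ((ν : ℂ) * cayley a z) (hlt ν) := by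
    refine Continuous.upperHalfPlaneMk ?_ _
    refine Continuous.div ?_ ?_ fun ν => one_sub_ne_zero_of_norm_lt_one (hlt ν)
    · fun_prop
    · fun_prop
  have hpow : ∀ n : ℤ, h (cayleyInv a (((μ ^ n : Circle) : ℂ) * cayley a z) (hlt _)) = 0 := by
    have hstep : ∀ ν : Circle, (A : GL (Fin 2) ℝ) • cayleyInv a ((ν : ℂ) * cayley a z) (hlt ν)
        = cayleyInv a (((μ * ν : Circle) : ℂ) * cayley a z) (hlt _) := by
      intro ν
      refine (cayleyInv_eq a _ _ ?_).symm
      rw [cayley_smul hA ha, cayley_cayleyInv, Circle.coe_mul, hμ, mul_assoc]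
    intro n
    induction n using Int.induction_on with
    | zero =>
      rw [cayleyInv_eq a z]
      · exact hz
      · simp
    | succ n ih =>
      rw [← hzero, hstep] at ih
      convert ih using 6
      rw [add_comm, zpow_add, zpow_one]
    | pred n ih =>
      rw [← hzero, hstep]
      convert ih using 6
      rw [← zpow_one_add, add_sub_cancel]
  have hall : ∀ ν : Circle, h (cayleyInv a ((ν : ℂ) * cayley a z) (hlt ν)) = 0 := by
    have := (denseRange_zpow_circle hμn).equalizer (hc.comp hcontM)
      (continuous_const (y := (0 : ℂ))) (funext hpow)
    exact congrFun this
  have hnorm : ‖cayley a w / cayley a z‖ = 1 := by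
    rw [norm_div, norm_cayley a w, ← hzw, ← norm_cayley, div_self (norm_ne_zero_iff.2 hcz)]
  have hw := hall ⟨cayley a w / cayley a z, mem_sphere_zero_iff_norm.2 hnorm⟩
  rwa [cayleyInv_eq a w] at hw
  exact (div_mul_cancel₀ _ hcz).symm

/-- A continuous function of nonzero weight which is invariant under two elliptic elements of
infinite order with distinct fixed points vanishes. -/
theorem eq_zero_of_two_elliptic {k : ℤ} (hk : k < 0) {h : ℍ → ℂ} (hc : Continuous h)
    {A B : GL(2, ℝ)⁺} {a b : ℍ} (hab : a ≠ b)
    (hA : (A : GL (Fin 2) ℝ).1.det = 1) (hB : (B : GL (Fin 2) ℝ).1.det = 1)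
    (ha : (A : GL (Fin 2) ℝ) • a = a) (hb : (B : GL (Fin 2) ℝ) • b = b)
    (hja : ∀ n : ℕ, 0 < n → denom (A : GL (Fin 2) ℝ) a ^ n ≠ 1)
    (hjb : ∀ n : ℕ, 0 < n → denom (B : GL (Fin 2) ℝ) b ^ n ≠ 1)
    (hhA : slashOp k h A = h) (hhB : slashOp k h B = h) : h = 0 := by
  -- At the fixed point invariance reads h(a) = j^{-k} h(a), and j^{-k} ≠ 1 because −k > 0.
  have h0 : h a = 0 := by
    have hx := congrFun hhA a
    rw [slashOp, ha, hA] at hx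
    have hne : denom (A : GL (Fin 2) ℝ) a ^ (-k) ≠ 1 := by
      obtain ⟨n, hn⟩ := Int.eq_ofNat_of_zero_le (by omega : 0 ≤ -k)
      rw [hn, zpow_natCast]
      exact hja n (by omega)
    by_contra hne0
    apply hne
    simpa [hne0] using hx
  funext z
  exact mem_of_dist_invariant hab (Z := {z | h z = 0}) h0
    (fun _ _ hd hz => eq_zero_of_dist_eq hc hA ha hja hhA hd hz)
    (fun _ _ hd hz => eq_zero_of_dist_eq hc hB hb hjb hhB hd hz) z

end Rotations

/-! ### Fixed points and infinite order. -/

section EllipticElements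

open ComplexConjugate

variable {A : GL(2, ℝ)⁺} {a b c d : ℝ}

/-- The fixed point of an elliptic matrix. -/
lemma exists_fixed_point (hA : (A : GL (Fin 2) ℝ).1 = !![a, b; c, d]) (hdet : a * d - b * c = 1)
    (hc : c ≠ 0) (htr : (a + d) ^ 2 < 4) :
    ∃ z : ℍ, (A : GL (Fin 2) ℝ) • z = z ∧ z.re = (a - d) / (2 * c) := by
  have hs : 0 < √(4 - (a + d) ^ 2) := Real.sqrt_pos.2 (by linarith)
  have hs2 : √(4 - (a + d) ^ 2) ^ 2 = 4 - (a + d) ^ 2 := Real.sq_sqrt (by linarith)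
  set s := √(4 - (a + d) ^ 2)
  have hc' : 0 < |c| := abs_pos.2 hc
  have hc2 : |c| ^ 2 = c ^ 2 := sq_abs c
  let z : ℍ := ⟨⟨(a - d) / (2 * c), s / (2 * |c|)⟩, by change 0 < s / (2 * |c|); positivity⟩
  refine ⟨z, ?_, rfl⟩
  apply UpperHalfPlane.ext
  rw [coe_smul_of_det_pos (glPos_det_pos A), div_eq_iff (denom_ne_zero _ z)]
  have hre : (z : ℂ).re = (a - d) / (2 * c) := rfl
  have him : (z : ℂ).im = s / (2 * |c|) := rfl
  simp only [num, denom, hA, Matrix.of_apply, Matrix.cons_val', Matrix.cons_val_zero,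
    Matrix.cons_val_one, Matrix.cons_val_fin_one]
  apply Complex.ext
  · simp only [Complex.add_re, Complex.mul_re, Complex.ofReal_re, Complex.ofReal_im,
      Complex.add_im, Complex.mul_im, hre, him]
    have h1 : (s / (2 * |c|)) * (s / (2 * |c|)) = (4 - (a + d) ^ 2) / (4 * c ^ 2) := by
      rw [← hs2, ← hc2]; field_simp; ring
    have h2 : (s / (2 * |c|)) * (c * (s / (2 * |c|))) = c * ((4 - (a + d) ^ 2) / (4 * c ^ 2)) := by
      rw [← h1]; ring
    simp only [zero_mul, sub_zero, add_zero]
    rw [h2]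
    field_simp
    linear_combination (-16 : ℝ) * hdet
  · simp only [Complex.add_re, Complex.mul_re, Complex.ofReal_re, Complex.ofReal_im,
      Complex.add_im, Complex.mul_im, hre, him]
    field_simp
    ring

/-- If the trace of a matrix fixing `z` is a rational number which is not an integer, then the
automorphy factor at `z` is not a root of unity. -/
lemma denom_pow_ne_one (hA : (A : GL (Fin 2) ℝ).1 = !![a, b; c, d]) (hc : c ≠ 0) {z : ℍ}
    (hz : z.re = (a - d) / (2 * c)) {q : ℚ} (hq : a + d = q) (hq' : ∀ t : ℤ, q ≠ t)
    (n : ℕ) (hn : 0 < n) : denom (A : GL (Fin 2) ℝ) z ^ n ≠ 1 := by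
  intro h
  -- If j is a root of unity, the trace j + j̄ is an algebraic integer; being rational, it is then
  -- an integer.
  have hint : ∀ x : ℂ, x ^ n = 1 → IsIntegral ℤ x := fun x hx =>
    IsIntegral.of_pow hn (hx ▸ isIntegral_one)
  have hj := hint _ h
  have hj' := hint (conj (denom (A : GL (Fin 2) ℝ) z)) (by rw [← map_pow, h, map_one])
  have hsum : denom (A : GL (Fin 2) ℝ) z + conj (denom (A : GL (Fin 2) ℝ) z) = (q : ℂ) := by
    rw [Complex.add_conj]
    have : (denom (A : GL (Fin 2) ℝ) z).re = c * z.re + d := by simp [denom, hA]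
    rw [this, hz, ← Complex.ofReal_ratCast, ← hq]
    congr 1
    field_simp
    ring
  have h3 : IsIntegral ℤ (algebraMap ℚ ℂ q) := by
    have := hj.add hj'
    rwa [hsum] at this
  rw [isIntegral_algebraMap_iff (algebraMap ℚ ℂ).injective] at h3
  obtain ⟨t, ht⟩ := IsIntegrallyClosed.isIntegral_iff.1 h3
  exact hq' t (by simpa using ht.symm)

end EllipticElements

/-! ### Primitive characters and orthogonality. -/

section Characters

/-- The discrete Fourier transform of a primitive ψ is a multiple of its Gauss sum; if that were 0,
injectivity would give ψ = 0, against ψ(1) = 1. -/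
lemma gaussSum_ne_zero_of_isPrimitive {M : ℕ} [NeZero M] {ψ : DirichletCharacter ℂ M}
    (hψ : ψ.IsPrimitive) : dirichletGaussSum ψ ≠ 0 := by
  intro h0
  have h : ZMod.dft (ψ : ZMod M → ℂ) = 0 := by
    funext a
    have := gaussSum_mulShift_of_isPrimitive (ZMod.stdAddChar (N := M)) hψ (-a)
    rw [dirichletGaussSum] at h0
    rw [DirichletCharacter.fourierTransform_eq_gaussSum_mulShift, this, h0, mul_zero]
    rfl
  rw [LinearEquiv.map_eq_zero_iff] at h
  have := congrFun h 1
  simp at this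

/-- The only proper divisor other than 1 to exclude is 2, for M = 4, and (ℤ/2)ˣ is trivial. -/
lemma isPrimitive_of_ne_one {M : ℕ} [NeZero M] (hM : IsOddPrimeOrFour M)
    {ψ : DirichletCharacter ℂ M} (hψ : ψ ≠ 1) : ψ.IsPrimitive := by
  have hdvd := ψ.conductor_dvd_level
  have hne : ψ.conductor ≠ 1 := fun h =>
    hψ (DirichletCharacter.eq_one_iff_conductor_eq_one.2 h)
  rw [DirichletCharacter.isPrimitive_def]
  rcases hM with ⟨hp, -⟩ | rfl
  · exact ((Nat.dvd_prime hp).1 hdvd).resolve_left hne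
  · have h2 : ψ.conductor ≠ 2 := by
      intro h2
      have hf := ψ.factorsThrough_conductor
      rw [h2] at hf
      obtain ⟨_, χ₀, hχ₀⟩ := hf
      have h1 : χ₀ = 1 := by
        ext u
        have : u = 1 := Subsingleton.elim _ _
        simp [this]
      exact hψ (by rw [hχ₀, h1, map_one])
    have hle : ψ.conductor ≤ 4 := Nat.le_of_dvd (by norm_num) hdvd
    interval_cases ψ.conductor <;> simp_all

/-- A function on the units which is orthogonal to all nontrivial characters is constant. -/
lemma eq_of_orthogonal {M : ℕ} [NeZero M] {D : (ZMod M)ˣ → ℂ}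
    (hD : ∀ ψ : DirichletCharacter ℂ M, ψ ≠ 1 → ∑ v : (ZMod M)ˣ, ψ v * D v = 0)
    (a b : (ZMod M)ˣ) : D a = D b := by
  have key (a : (ZMod M)ˣ) : (M.totient : ℂ) * D a = ∑ v, D v := by
    have h1 : ∑ ψ : DirichletCharacter ℂ M, ψ (a : ZMod M)⁻¹ * ∑ v : (ZMod M)ˣ, ψ v * D v
        = ∑ v, D v := by
      -- Only the trivial character survives in Fourier inversion, and its term does not depend on
      -- a.
      rw [Finset.sum_eq_single 1 (fun ψ _ hψ => by rw [hD ψ hψ, mul_zero]) (by simp)]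
      rw [ZMod.inv_coe_unit]
      simp
    rw [← h1]
    simp_rw [Finset.mul_sum, ← mul_assoc]
    rw [Finset.sum_comm]
    simp_rw [← Finset.sum_mul, DirichletCharacter.sum_char_inv_mul_char_eq ℂ a.isUnit,
      Units.val_inj, ite_mul, zero_mul]
    simp
  have ht : (M.totient : ℂ) ≠ 0 := by
    exact_mod_cast (Nat.totient_pos.2 (Nat.pos_of_ne_zero (NeZero.ne M))).ne'
  exact mul_left_cancel₀ ht ((key a).trans (key b).symm)

lemma sum_char_smul_eq_sum_units {M : ℕ} [NeZero M] {E : Type*} [AddCommMonoid E] [Module ℂ E]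
    (ψ : DirichletCharacter ℂ M) (X : ZMod M → E) :
    ∑ a : ZMod M, ψ a • X a = ∑ v : (ZMod M)ˣ, ψ v • X v := by
  symm
  refine Fintype.sum_of_injective _ Units.val_injective _ _ (fun a ha => ?_) fun _ => rfl
  rw [MulChar.map_nonunit ψ fun ⟨u, hu⟩ => ha ⟨u, hu⟩, zero_smul]

end Characters

/-! ### From twisted functional equations to a constant defect. -/

section Twists

/-- The translate of `F` by a residue class `a / M`. -/
noncomputable def residueShift (k : ℤ) (F : ℍ → ℂ) {M : ℕ} (a : ZMod M) : ℍ → ℂ :=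
  slashOp k F (shiftMatrix ((a.val : ℝ) / M))

lemma slashOp_shift_div {k : ℤ} {F : ℍ → ℂ} (hF : slashOp k F (shiftMatrix 1) = F) {M : ℕ}
    [NeZero M] (a : ℤ) :
    slashOp k F (shiftMatrix ((a : ℝ) / M)) = residueShift k F (a : ZMod M) := by
  have hM : (M : ℝ) ≠ 0 := by exact_mod_cast NeZero.ne M
  have hval : (((a : ZMod M).val : ℤ) : ℝ) = a - M * (a / M : ℤ) := by
    rw [ZMod.val_intCast, Int.emod_def]; push_cast; ring
  have : (a : ℝ) / M = (a / M : ℤ) + ((a : ZMod M).val : ℝ) / M := by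
    rw [Int.cast_natCast] at hval
    rw [hval]; field_simp; ring
  rw [residueShift, this, shiftMatrix_add, slashOp_mul, slashOp_shiftMatrix_int hF]

variable {k : ℤ} {f g : FourierCoeffs}

lemma FourierCoeffs.PolyBounded.slashOp_shift_one (hf : f.PolyBounded) (hk : k < 0) :
    slashOp k (f.toFun k) (shiftMatrix 1) = f.toFun k := by
  funext τ
  rw [slashOp_shiftMatrix, hf.toFun_one_vadd hk]

lemma FourierCoeffs.PolyBounded.gaussSum_smul_twist (hf : f.PolyBounded) (hk : k < 0) {M : ℕ}
    [NeZero M] {ψ : DirichletCharacter ℂ M} (hψ : (star ψ).IsPrimitive) :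
    dirichletGaussSum (star ψ) • (f.twist ψ).toFun k
      = ∑ v : (ZMod M)ˣ, star ψ v • residueShift k (f.toFun k) (v : ZMod M) := by
  rw [← sum_char_smul_eq_sum_units (star ψ) fun a => residueShift k (f.toFun k) a]
  funext τ
  simp only [Pi.smul_apply, smul_eq_mul, hf.gaussSum_mul_toFun_twist hk hψ, Finset.sum_apply,
    residueShift, slashOp_shiftMatrix]

variable {N M : ℕ} [NeZero N] [NeZero M] {χ : DirichletCharacter ℂ N}

instance neZero_mul_sq : NeZero (N * M ^ 2) :=
  ⟨mul_ne_zero (NeZero.ne N) (pow_ne_zero 2 (NeZero.ne M))⟩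

/-- The defect function whose character sums are controlled by the twisted relations. -/
noncomputable def twistDefect (k : ℤ) (χ : DirichletCharacter ℂ N) (f g : FourierCoeffs)
    (ν v : (ZMod M)ˣ) : ℍ → ℂ :=
  χ (M : ZMod N) • residueShift k (g.toFun k) (v : ZMod M)
    - slashOp k (residueShift k (f.toFun k) (((ν * v)⁻¹ : (ZMod M)ˣ) : ZMod M))
        (frickeMatrix (N * M ^ 2))

/-- Multiply the relation by τ(ψ̄): f_ψ becomes a sum of translates, and τ(ψ̄) C_ψ = ψ(ν) χ(M) τ(ψ)
supplies exactly the factor that does the same for g_ψ̄. -/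
lemma sum_twistDefect (hk : k < 0) (hf : f.PolyBounded) (hg : g.PolyBounded)
    {ν : (ZMod M)ˣ} (hν : (ν : ZMod M) = -(N : ZMod M)) {ψ : DirichletCharacter ℂ M}
    (hψ : ψ.IsPrimitive) (hψ' : (star ψ).IsPrimitive) (hrel : TwistedFrickeRelation k χ f g ψ) :
    ∑ v : (ZMod M)ˣ, ψ v • twistDefect k χ f g ν v = 0 := by
  have hg0 := gaussSum_ne_zero_of_isPrimitive hψ'
  have hψν : ψ ν ≠ 0 := (ν.isUnit.map ψ).ne_zero
  have hF := congrArg (fun F => slashOp k F (frickeMatrix (N * M ^ 2)))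
    (hf.gaussSum_smul_twist hk hψ')
  have hstar : star (star ψ) = ψ := star_star ψ
  have hG := hg.gaussSum_smul_twist hk (ψ := star ψ) (by rwa [hstar])
  rw [hstar] at hG
  have hrel' : slashOp k ((f.twist ψ).toFun k) (frickeMatrix (N * M ^ 2))
    = twistConst χ ψ • (g.twist (star ψ)).toFun k := hrel
  simp only [slashOp_smul, slashOp_sum] at hF
  rw [hrel', smul_smul] at hF
  have hconst : dirichletGaussSum (star ψ) * twistConst χ ψ
      = ψ ν * (χ (M : ZMod N) * dirichletGaussSum ψ) := by
    rw [twistConst, hν]; field_simp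
  have hreindex : ∑ v : (ZMod M)ˣ, star ψ v • slashOp k
        (residueShift k (f.toFun k) (v : ZMod M)) (frickeMatrix (N * M ^ 2))
      = ψ ν • ∑ v : (ZMod M)ˣ, ψ v • slashOp k
        (residueShift k (f.toFun k) (((ν * v)⁻¹ : (ZMod M)ˣ) : ZMod M))
          (frickeMatrix (N * M ^ 2)) := by
    rw [Finset.smul_sum]
    -- Since ψ̄((νv)⁻¹) = ψ(ν)ψ(v), this substitution gives both sides the coefficients ψ(v) and a
    -- common factor ψ(ν) to cancel.
    have hinv : Function.Involutive fun u : (ZMod M)ˣ => (ν * u)⁻¹ := fun u => by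
      simp [mul_inv_rev]
    refine (Fintype.sum_equiv hinv.toPerm _ _ fun v => ?_).symm
    change _ = star ψ (((ν * v)⁻¹ : (ZMod M)ˣ) : ZMod M) • _
    rw [smul_smul, MulChar.star_eq_inv, MulChar.inv_apply, ← map_mul]
    congr 2
    rw [Ring.inverse_unit, inv_inv, Units.val_mul]
  rw [hconst, hreindex, mul_smul, mul_smul, hG] at hF
  have hF' := smul_right_injective (ℍ → ℂ) hψν hF
  simp only [twistDefect, smul_sub, Finset.sum_sub_distrib]
  rw [← hF', Finset.smul_sum, sub_eq_zero]
  exact Finset.sum_congr rfl fun v _ => smul_comm _ _ _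

lemma twistDefect_eq (hk : k < 0) (hf : f.PolyBounded) (hg : g.PolyBounded)
    (hM : IsOddPrimeOrFour M) {ν : (ZMod M)ˣ} (hν : (ν : ZMod M) = -(N : ZMod M))
    (hrel : ∀ ψ : DirichletCharacter ℂ M, ψ.IsPrimitive → TwistedFrickeRelation k χ f g ψ)
    (v w : (ZMod M)ˣ) : twistDefect k χ f g ν v = twistDefect k χ f g ν w := by
  funext τ
  refine eq_of_orthogonal (D := fun v => twistDefect k χ f g ν v τ) (fun ψ hψ => ?_) v w
  have hψ' : star ψ ≠ 1 := by rwa [MulChar.star_eq_inv, ne_eq, inv_eq_one]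
  have h := congrFun (sum_twistDefect hk hf hg hν (isPrimitive_of_ne_one hM hψ)
    (isPrimitive_of_ne_one hM hψ') (hrel ψ (isPrimitive_of_ne_one hM hψ))) τ
  simpa using h

end Twists

/-! ### Integral matrices of determinant one. -/

section IntegralMatrices

/-- An integral matrix of determinant one as an element of `GL(2, ℝ)⁺`. -/
noncomputable def intGL (a b c d : ℤ) (h : a * d - b * c = 1) : GL(2, ℝ)⁺ :=
  glPosMk a b c d (by
    have : (a : ℝ) * d - b * c = 1 := by exact_mod_cast h
    rw [this]; exact one_pos)

@[simp]
lemma coe_intGL (a b c d : ℤ) (h : a * d - b * c = 1) :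
    (intGL a b c d h : GL (Fin 2) ℝ).1 = !![(a : ℝ), b; c, d] := rfl

lemma matrix_two_congr {R : Type*} {a b c d a' b' c' d' : R} (h₁ : a = a') (h₂ : b = b')
    (h₃ : c = c') (h₄ : d = d') : !![a, b; c, d] = !![a', b'; c', d'] := by
  rw [h₁, h₂, h₃, h₄]

lemma intGL_congr {a b c d a' b' c' d' : ℤ} {h : a * d - b * c = 1} (h₁ : a = a') (h₂ : b = b')
    (h₃ : c = c') (h₄ : d = d') :
    intGL a b c d h = intGL a' b' c' d' (by rw [← h₁, ← h₂, ← h₃, ← h₄, h]) := by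
  subst h₁ h₂ h₃ h₄
  rfl

lemma intGL_inv (a b c d : ℤ) (h : a * d - b * c = 1) :
    (intGL a b c d h)⁻¹ = intGL d (-b) (-c) a (by linarith) := by
  have h' : (a : ℝ) * d - b * c = 1 := by exact_mod_cast h
  rw [inv_eq_iff_mul_eq_one]
  apply glPos_ext
  rw [Subgroup.coe_mul, Units.val_mul, coe_intGL, coe_intGL, Matrix.mul_fin_two]
  change _ = (1 : Matrix (Fin 2) (Fin 2) ℝ)
  rw [Matrix.one_fin_two]
  apply matrix_two_congr <;> push_cast <;> linarith

lemma shiftMatrix_inv (x : ℝ) : (shiftMatrix x)⁻¹ = shiftMatrix (-x) := by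
  rw [inv_eq_iff_mul_eq_one, ← shiftMatrix_add, add_neg_cancel]
  apply glPos_ext
  change _ = (1 : Matrix (Fin 2) (Fin 2) ℝ)
  rw [coe_shiftMatrix, Matrix.one_fin_two]

end IntegralMatrices

/-! ### Weil's elliptic matrix. -/

section Invariance

variable {k : ℤ} {f g : FourierCoeffs} {N : ℕ} [NeZero N] {χ : DirichletCharacter ℂ N}

/-- Two opposite translates give the same defect. -/
lemma slashOp_defect_eq (hk : k < 0) (hf : f.PolyBounded) (hg : g.PolyBounded)
    (hfg : slashOp k (f.toFun k) (frickeMatrix N) = g.toFun k) {M : ℕ} [NeZero M]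
    (hM : IsOddPrimeOrFour M)
    (hrel : ∀ ψ : DirichletCharacter ℂ M, ψ.IsPrimitive → TwistedFrickeRelation k χ f g ψ)
    {n u v : ℤ} (h : (M : ℤ) * n - -v * (-N * u) = 1) (h' : (M : ℤ) * n - v * (N * u) = 1) :
    slashOp k (χ (M : ZMod N) • g.toFun k
        - slashOp k (g.toFun k) (intGL M (-v) (-N * u) n h)) (shiftMatrix (v / M))
      = slashOp k (χ (M : ZMod N) • g.toFun k
        - slashOp k (g.toFun k) (intGL M v (N * u) n h')) (shiftMatrix (-(v / M))) := by
  have hMpos : (0 : ℝ) < M := by exact_mod_cast Nat.pos_of_ne_zero (NeZero.ne M)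
  have hNuv : (-(N : ZMod M)) * ((v : ZMod M) * (u : ZMod M)) = 1 := by
    have := congrArg (Int.cast : ℤ → ZMod M) h
    push_cast at this
    rw [ZMod.natCast_self] at this
    linear_combination this
  obtain ⟨ν, hν⟩ : IsUnit (-(N : ZMod M)) := IsUnit.of_mul_eq_one _ hNuv
  have main : ∀ (a b : ℤ) (hab : (M : ℤ) * n - -a * (-N * b) = 1), ∃ w : (ZMod M)ˣ,
      slashOp k (χ (M : ZMod N) • g.toFun k
        - slashOp k (g.toFun k) (intGL M (-a) (-N * b) n hab)) (shiftMatrix (a / M))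
      = twistDefect k χ f g ν w := by
    intro a b hab
    have hNab : (-(N : ZMod M)) * (a : ZMod M) * (b : ZMod M) = 1 := by
      have := congrArg (Int.cast : ℤ → ZMod M) hab
      push_cast at this
      rw [ZMod.natCast_self] at this
      linear_combination this
    obtain ⟨w, hw⟩ : IsUnit (a : ZMod M) :=
      IsUnit.of_mul_eq_one (-(N : ZMod M) * b) (by linear_combination hNab)
    have hb : (((ν * w)⁻¹ : (ZMod M)ˣ) : ZMod M) = b := by
      rw [← mul_one (((ν * w)⁻¹ : (ZMod M)ˣ) : ZMod M), Units.inv_mul_eq_iff_eq_mul,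
        Units.val_mul, hν, hw, hNab]
    refine ⟨w, ?_⟩
    rw [twistDefect, hb, hw, slashOp_sub, slashOp_smul,
      ← slashOp_shift_div (hg.slashOp_shift_one hk), ← slashOp_shift_div (hf.slashOp_shift_one hk)]
    congr 1
    rw [← hfg, ← slashOp_mul, ← slashOp_mul, ← slashOp_mul]
    -- With T^x the translation by x and γ = (M, −a; −Nb, n), the identity is T^{b/M} ω(NM²) = M ·
    -- ω(N) γ T^{a/M}.
    refine (slashOp_eq_of_smul k _ hMpos ?_).symm
    have hR : (M : ℝ) * n - a * (N * b) = 1 := by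
      have := congrArg (Int.cast : ℤ → ℝ) hab
      push_cast at this
      linarith
    simp only [Subgroup.coe_mul, Units.val_mul, coe_shiftMatrix, coe_frickeMatrix, coe_intGL,
      Matrix.mul_fin_two, Matrix.smul_of, Matrix.smul_cons, Matrix.smul_empty, smul_eq_mul]
    push_cast
    apply matrix_two_congr
    · field_simp; ring
    · field_simp; linear_combination (M : ℝ) * hR
    · field_simp; ring
    · field_simp; ring
  obtain ⟨w₁, h₁⟩ := main v u h
  obtain ⟨w₂, h₂⟩ := main (-v) (-u) (by linarith)
  have hcast : ((-v : ℤ) : ℝ) / M = -(v / M) := by push_cast; ring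
  rw [intGL_congr rfl (neg_neg v) (neg_mul_neg (N : ℤ) u) rfl, hcast] at h₂
  rw [h₁, twistDefect_eq hk hf hg hM hν hrel w₁ w₂, ← h₂]

/-- The formal part of Weil's argument. -/
lemma slashOp_eq_of_defect_eq {G : ℍ → ℂ} {a b : ℂ} (hab : a * b = 1) {γ γ' s t : GL(2, ℝ)⁺}
    (h1 : slashOp k (a • G - slashOp k G γ) s = slashOp k (a • G - slashOp k G γ') s⁻¹)
    (h2 : slashOp k (b • G - slashOp k G γ'⁻¹) t = slashOp k (b • G - slashOp k G γ⁻¹) t⁻¹) :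
    slashOp k (a • G - slashOp k G γ) (γ⁻¹ * t⁻¹ * t⁻¹ * γ' * s⁻¹ * s⁻¹)
      = a • G - slashOp k G γ := by
  have hb : b ≠ 0 := right_ne_zero_of_mul_eq_one hab
  -- The second hypothesis thus also concerns the two defects h and h' of γ and γ'. The hypotheses
  -- become h = h'|s⁻² and h' = h|γ⁻¹t⁻²γ', which compose.
  have hinv : ∀ δ : GL(2, ℝ)⁺, b • G - slashOp k G δ⁻¹
      = (-b) • slashOp k (a • G - slashOp k G δ) δ⁻¹ := by
    intro δ
    rw [slashOp_sub, slashOp_smul, ← slashOp_mul, mul_inv_cancel, slashOp_one, smul_sub, smul_smul,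
      neg_mul, mul_comm b a, hab]
    module
  rw [hinv, hinv, slashOp_smul, slashOp_smul] at h2
  have h2' := smul_right_injective (ℍ → ℂ) (neg_ne_zero.2 hb) h2
  have e1 := congrArg (fun F => slashOp k F s⁻¹) h1
  have e2 := congrArg (fun F => slashOp k F (t⁻¹ * γ')) h2'
  simp only [← slashOp_mul, mul_inv_cancel, slashOp_one] at e1 e2
  have e3 : γ'⁻¹ * t * (t⁻¹ * γ') = 1 := by group
  rw [e3, slashOp_one] at e2
  conv_rhs => rw [e1, e2, ← slashOp_mul]
  congr 1
  group

/-- The elliptic matrix in Weil's argument. -/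
lemma exists_elliptic {N m n : ℕ} (hm : 3 ≤ m) (hn : 3 ≤ n) {u v : ℤ}
    (h : (m : ℤ) * n - -v * (-N * u) = 1) (h' : (m : ℤ) * n - v * (N * u) = 1) :
    ∃ (B : GL(2, ℝ)⁺) (z : ℍ), B = (intGL m (-v) (-N * u) n h)⁻¹ * (shiftMatrix (v / n))⁻¹
        * (shiftMatrix (v / n))⁻¹ * intGL m v (N * u) n h' * (shiftMatrix (v / m))⁻¹
        * (shiftMatrix (v / m))⁻¹ ∧
      (B : GL (Fin 2) ℝ).1.det = 1 ∧ (B : GL (Fin 2) ℝ) • z = z ∧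
      z.re = (n - 1 / m) / (N * u) ∧ ∀ j : ℕ, 0 < j → denom (B : GL (Fin 2) ℝ) z ^ j ≠ 1 := by
  have hm0 : (m : ℝ) ≠ 0 := by positivity
  have hn0 : (n : ℝ) ≠ 0 := by positivity
  have hmn : (9 : ℤ) ≤ (m : ℤ) * n := by exact_mod_cast Nat.mul_le_mul hm hn
  have hmnR : (9 : ℝ) ≤ (m : ℝ) * n := by exact_mod_cast hmn
  have hR : (m : ℝ) * n - v * (N * u) = 1 := by exact_mod_cast h'
  have hNu : (N : ℝ) * u ≠ 0 := fun h0 => by rw [h0] at hR; linarith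
  have hNu' : (N : ℝ) ≠ 0 ∧ (u : ℝ) ≠ 0 := mul_ne_zero_iff.1 hNu
  obtain ⟨B, hB⟩ : ∃ B, B = (intGL m (-v) (-N * u) n h)⁻¹ * (shiftMatrix (v / n))⁻¹
      * (shiftMatrix (v / n))⁻¹ * intGL m v (N * u) n h' * (shiftMatrix (v / m))⁻¹
      * (shiftMatrix (v / m))⁻¹ := ⟨_, rfl⟩
  have hmat : (B : GL (Fin 2) ℝ).1
      = !![(1 : ℝ), -2 * v / m; 2 * (N * u) / n, -3 + 4 / (m * n : ℝ)] := by
    rw [hB, intGL_inv, shiftMatrix_inv, shiftMatrix_inv]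
    simp only [Subgroup.coe_mul, Units.val_mul, coe_shiftMatrix, coe_intGL, Matrix.mul_fin_two]
    push_cast
    apply matrix_two_congr
    · field_simp
      linear_combination ((m : ℝ) * n) * hR
    · field_simp
      linear_combination (-2 * (v : ℝ) * n) * hR
    · field_simp
      linear_combination (2 * (m : ℝ) * N * u) * hR
    · field_simp
      linear_combination ((m : ℝ) * n - 4 * (v * N * u) + 4) * hR
  have hdet : (1 : ℝ) * (-3 + 4 / (m * n : ℝ)) - -2 * v / m * (2 * (N * u) / n) = 1 := by
    field_simp
    linear_combination (-4 : ℝ) * hR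
  have hc : 2 * ((N : ℝ) * u) / n ≠ 0 := by positivity
  -- As mn ≥ 9, the trace 4/(mn) − 2 lies strictly between −2 and −1: elliptic and not an integer.
  have hsmall : 4 / ((m : ℝ) * n) < 1 := by rw [div_lt_one (by linarith)]; linarith
  have hpos : 0 < 4 / ((m : ℝ) * n) := by positivity
  obtain ⟨z, hz, hre⟩ := exists_fixed_point hmat hdet hc (by nlinarith)
  refine ⟨B, z, hB, by rw [hmat, Matrix.det_fin_two_of, hdet], hz, ?_, ?_⟩
  · rw [hre]
    field_simp
    ring
  · refine denom_pow_ne_one hmat hc hre (q := 4 / (m * n) - 2) (by push_cast; ring) fun t ht => ?_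
    have htR : 4 / ((m : ℝ) * n) = ((t + 2 : ℤ) : ℝ) := by
      have := congrArg (Rat.cast : ℚ → ℝ) ht
      push_cast at this ⊢
      linarith
    rw [htR] at hsmall hpos
    have h1 : t + 2 < 1 := by exact_mod_cast hsmall
    have h2 : 0 < t + 2 := by exact_mod_cast hpos
    omega

end Invariance

/-! ### A second elliptic matrix and the conclusion. -/

lemma IsOddPrimeOrFour.three_le {M : ℕ} (hM : IsOddPrimeOrFour M) : 3 ≤ M := by
  rcases hM with ⟨hp, ho⟩ | rfl
  · have := hp.two_le
    rcases ho with ⟨r, rfl⟩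
    omega
  · norm_num

/-- There is an element of a twist set congruent to `m` modulo `x`, but different from `m`. -/
lemma IsTwistSet.exists_ne {N : ℕ} {P : Set ℕ} (hP : IsTwistSet N P) {m : ℕ} (hm : 3 ≤ m) {x : ℤ}
    (hx : x ≠ 0) (hmx : IsCoprime (m : ℤ) x) : ∃ p ∈ P, p ≠ m ∧ ∃ s : ℤ, (p : ℤ) = m - s * x := by
  have hm0 : (m : ℤ) ≠ 0 := by omega
  -- The class of m + x modulo mx lies over m modulo x, but p = m would force m to divide 1.
  have hcop : IsCoprime ((m : ℤ) + x) (m * x) := by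
    refine IsCoprime.mul_right ?_ ?_
    · have := hmx.symm.add_mul_left_left 1
      rwa [mul_one, add_comm] at this
    · have := hmx.add_mul_left_left 1
      rwa [mul_one] at this
  obtain ⟨p, hp, t, ht⟩ := hP.2 (m + x) (m * x) (mul_ne_zero hm0 hx) hcop
  refine ⟨p, hp, fun hpm => ?_, -(1 + t * m), by rw [ht]; ring⟩
  rw [hpm] at ht
  have h1 : x * (1 + t * m) = 0 := by linear_combination -ht
  have h2 : (1 : ℤ) + t * m = 0 := (mul_eq_zero.1 h1).resolve_left hx
  have h3 : (m : ℤ) ∣ 1 := ⟨-t, by linear_combination h2⟩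
  have := Int.le_of_dvd one_pos h3
  omega

/-- The defect `χ(m) g - g|γ` is invariant under an elliptic matrix of infinite order. -/
lemma exists_elliptic_slashOp_defect {k : ℤ} (hk : k < 0) {f g : FourierCoeffs} {N : ℕ} [NeZero N]
    {χ : DirichletCharacter ℂ N} (hf : f.PolyBounded) (hg : g.PolyBounded)
    (hfg : slashOp k (f.toFun k) (frickeMatrix N) = g.toFun k) {m n : ℕ}
    (hm : IsOddPrimeOrFour m) (hn : IsOddPrimeOrFour n)
    (htwist : ∀ (M : ℕ) [NeZero M], (M = m ∨ M = n) →
      ∀ ψ : DirichletCharacter ℂ M, ψ.IsPrimitive → TwistedFrickeRelation k χ f g ψ)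
    {u v : ℤ} (h : (m : ℤ) * n - -v * (-N * u) = 1) :
    ∃ (B : GL(2, ℝ)⁺) (z : ℍ), (B : GL (Fin 2) ℝ).1.det = 1 ∧ (B : GL (Fin 2) ℝ) • z = z ∧
      z.re = (n - 1 / m) / (N * u) ∧ (∀ j : ℕ, 0 < j → denom (B : GL (Fin 2) ℝ) z ^ j ≠ 1) ∧
      slashOp k (χ (m : ZMod N) • g.toFun k
        - slashOp k (g.toFun k) (intGL m (-v) (-N * u) n h)) B
      = χ (m : ZMod N) • g.toFun k - slashOp k (g.toFun k) (intGL m (-v) (-N * u) n h) := by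
  have : NeZero m := ⟨by have := hm.three_le; omega⟩
  have : NeZero n := ⟨by have := hn.three_le; omega⟩
  have h' : (m : ℤ) * n - v * (N * u) = 1 := by linarith
  have hχ : χ (m : ZMod N) * χ (n : ZMod N) = 1 := by
    have := congrArg (Int.cast : ℤ → ZMod N) h'
    push_cast at this
    rw [ZMod.natCast_self, zero_mul, mul_zero, sub_zero] at this
    rw [← map_mul, this, map_one]
  have h1 := slashOp_defect_eq hk hf hg hfg hm (htwist m (Or.inl rfl)) h h'
  have h2 := slashOp_defect_eq hk hf hg hfg hn (htwist n (Or.inr rfl)) (n := m) (u := u) (v := v)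
    (by linarith) (by linarith)
  rw [← shiftMatrix_inv] at h1 h2
  have hinv : (intGL m (-v) (-N * u) n h)⁻¹ = intGL n v (N * u) m (by linarith) := by
    rw [intGL_inv]
    exact intGL_congr rfl (neg_neg v) (by ring) rfl
  have hinv' : (intGL m v (N * u) n h')⁻¹ = intGL n (-v) (-N * u) m (by linarith) := by
    rw [intGL_inv]
    exact intGL_congr rfl rfl (by ring) rfl
  rw [← hinv, ← hinv'] at h2
  obtain ⟨B, z, hB, hdet, hz, hre, hj⟩ := exists_elliptic hm.three_le hn.three_le h h'
  refine ⟨B, z, hdet, hz, hre, hj, ?_⟩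
  rw [hB]
  exact slashOp_eq_of_defect_eq hχ h1 h2

theorem mainTheorem6 (k : ℤ) (hk : k < 0) (N : ℕ) [NeZero N]
    (χ : DirichletCharacter ℂ N) (hχ : χ (-1) = (-1 : ℂ) ^ k)
    (f g : FourierCoeffs) (hf : f.PolyBounded) (hg : g.PolyBounded)
    (hfg : slashOp k (f.toFun k) (frickeMatrix N) = g.toFun k)
    (P : Set ℕ) (hP : IsTwistSet N P)
    (m n : ℕ) (hm : IsOddPrimeOrFour m) (hn : IsOddPrimeOrFour n)
    (hmN : m.Coprime N) (hnN : n.Coprime N)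
    (htwist : ∀ (M : ℕ) [NeZero M], (M = m ∨ M = n ∨ M ∈ P) →
      ∀ ψ : DirichletCharacter ℂ M, ψ.IsPrimitive → TwistedFrickeRelation k χ f g ψ)
    (u v : ℤ) (γ : SL(2, ℤ)) (hγN : γ ∈ CongruenceSubgroup.Gamma0 N)
    (hγ : (γ : Matrix (Fin 2) (Fin 2) ℤ) = !![(m : ℤ), -v; -(N : ℤ) * u, (n : ℤ)]) :
    slashOp k (g.toFun k) (intToGLPos γ)
      = fun τ => (starRingEnd ℂ) (χ (n : ZMod N)) * g.toFun k τ := by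
  have h : (m : ℤ) * n - -v * (-N * u) = 1 := by
    have := γ.det_coe
    rwa [hγ, Matrix.det_fin_two_of] at this
  have hmn : (9 : ℤ) ≤ (m : ℤ) * n := by exact_mod_cast Nat.mul_le_mul hm.three_le hn.three_le
  have hNu : (N : ℤ) * u ≠ 0 := fun h0 => by
    have : -(N : ℤ) * u = 0 := by linarith
    rw [this] at h; linarith
  obtain ⟨p, hpP, hpm, s, hs⟩ := hP.exists_ne hm.three_le hNu ⟨n, -v, by linear_combination h⟩
  have hp := (hP.1 p hpP).1
  have h₂ : (p : ℤ) * n - -(v - s * n) * (-N * u) = 1 := by rw [hs]; linear_combination h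
  have hpχ : (p : ZMod N) = m := by
    have := congrArg (Int.cast : ℤ → ZMod N) hs
    push_cast at this
    rwa [ZMod.natCast_self, zero_mul, mul_zero, sub_zero] at this
  -- The matrix with p is T^s γ, and g has period 1; with χ(p) = χ(m), both elliptic matrices fix
  -- the same h.
  have hdefect : slashOp k (g.toFun k) (intGL p (-(v - s * n)) (-N * u) n h₂)
      = slashOp k (g.toFun k) (intGL m (-v) (-N * u) n h) := by
    have hmat : intGL p (-(v - s * n)) (-N * u) n h₂
        = shiftMatrix s * intGL m (-v) (-N * u) n h := by
      apply glPos_ext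
      have hsR : (p : ℝ) = m - s * (N * u) := by exact_mod_cast hs
      rw [Subgroup.coe_mul, Units.val_mul, coe_shiftMatrix, coe_intGL, coe_intGL,
        Matrix.mul_fin_two]
      push_cast
      rw [hsR]
      apply matrix_two_congr <;> ring
    rw [hmat, slashOp_mul, slashOp_shiftMatrix_int (hg.slashOp_shift_one hk)]
  obtain ⟨A, a, hA, ha, hare, hja, hhA⟩ := exists_elliptic_slashOp_defect hk hf hg hfg hm hn
    (fun M _ hM => htwist M (by tauto)) h
  obtain ⟨B, b, hB, hb, hbre, hjb, hhB⟩ := exists_elliptic_slashOp_defect hk hf hg hfg hp hn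
    (fun M _ hM => htwist M (by rcases hM with rfl | rfl <;> simp [hpP])) h₂
  rw [hdefect, hpχ] at hhB
  -- The real parts (n − 1/m)/(Nu) and (n − 1/p)/(Nu) differ because p ≠ m.
  have hab : a ≠ b := by
    rintro rfl
    have hNuR : (N : ℝ) * u ≠ 0 := by exact_mod_cast hNu
    rw [hare, div_left_inj' hNuR, sub_right_inj, one_div, one_div, inv_inj] at hbre
    exact hpm (by exact_mod_cast hbre.symm)
  have hcont : Continuous (χ (m : ZMod N) • g.toFun k
      - slashOp k (g.toFun k) (intGL m (-v) (-N * u) n h)) :=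
    ((hg.continuous_toFun hk).const_smul _).sub (continuous_slashOp k (hg.continuous_toFun hk) _)
  have hzero := eq_zero_of_two_elliptic hk hcont hab hA hB ha hb hja hjb hhA hhB
  have hγ' : intToGLPos γ = intGL m (-v) (-N * u) n h := by
    apply glPos_ext
    have hcoe : (intToGLPos γ : GL (Fin 2) ℝ).1
        = (γ : Matrix (Fin 2) (Fin 2) ℤ).map (Int.castRingHom ℝ) := rfl
    rw [hcoe, hγ, coe_intGL]
    ext i j
    fin_cases i <;> fin_cases j <;> simp
  have hconj : (starRingEnd ℂ) (χ (n : ZMod N)) = χ (m : ZMod N) := by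
    have hmul : χ (m : ZMod N) * χ (n : ZMod N) = 1 := by
      have := congrArg (Int.cast : ℤ → ZMod N) h
      push_cast at this
      rw [ZMod.natCast_self, neg_zero, zero_mul, mul_zero, sub_zero] at this
      rw [← map_mul, this, map_one]
    rw [← RCLike.star_def, MulChar.star_apply', MulChar.inv_apply_eq_inv']
    exact (eq_inv_of_mul_eq_one_left hmul).symm
  rw [hγ', ← sub_eq_zero.1 hzero, hconj]
  rfl
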